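/- Let $1\le k<n$ be integers. Let $\Gamma_n$ be the quiver with vertex set $\mathbb Z/n$ and arrows $x_i\colon i-1\to i$ and $y_i\colon i\to i-1$ for $i\in\mathbb Z/n$, and let $B_{k,n}$ be the quotient of the completed path algebra of $\Gamma_n$ over $\mathbb C$ by the closure (in the topology given by the powers of the ideal generated by the arrows) of the two-sided ideal generated by the relations $xy-yx$ and $x^k-y^{n-k}$ at every vertex, where $x=\sum_i x_i$ and $y=\sum_i y_i$. Put $t=\sum_i x_iy_i$ and $Z=\mathbb C[[t]]$, the centre of $B_{k,n}$, and let $K$ be the field of fractions of $Z$. Let ${\rm CM}(B_{k,n})$ be the category of (maximal) Cohen–Macaulay $B_{k,n}$-modules, that is, of the left $B_{k,n}$-modules that are free of finite rank over $Z$; the rank of such a module $M$ is the length of $M\otimes_Z K$ as a module over $B_{k,n}\otimes_Z K$. A module is indecomposable if it is nonzero and is not the direct sum of two nonzero submodules. If $n<6$, then there are no indecomposable modules of rank $2$ in ${\rm CM}(B_{k,n})$. -/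

import Mathlib

open scoped PowerSeries TensorProduct

universe u

/-! ## The completed path algebra of a quiver -/

section CompletedPathAlgebra

variable {R : Type*} [CommRing R] {V : Type*} [Quiver V]

/-- All the ways of writing a path `p : a ⟶ ⋯ ⟶ b` as "first `q`, then `r`",
listed as triples (middle vertex, `q`, `r`). -/
def pathSplits {a : V} : ∀ {b : V}, Quiver.Path a b → List (Σ c : V, Quiver.Path a c × Quiver.Path c b)
  | _, .nil => [⟨a, .nil, .nil⟩]
  | _, .cons p e => ⟨_, p.cons e, .nil⟩ :: (pathSplits p).map fun s => ⟨s.1, s.2.1, s.2.2.cons e⟩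

variable (R V) in
/-- The completed path algebra of a quiver (with finitely many vertices and arrows):
its elements are the formal, possibly infinite, `R`-linear combinations of paths, an element being
given by the family of its coefficients. -/
def CompletedPathAlgebra : Type _ := ∀ a b : V, Quiver.Path a b → R

namespace CompletedPathAlgebra

instance : AddCommGroup (CompletedPathAlgebra R V) :=
  inferInstanceAs (AddCommGroup (∀ a b : V, Quiver.Path a b → R))

instance : Module R (CompletedPathAlgebra R V) :=
  inferInstanceAs (Module R (∀ a b : V, Quiver.Path a b → R))

set_option linter.unusedSectionVars false in
@[ext] theorem ext {f g : CompletedPathAlgebra R V} (h : ∀ a b (p : Quiver.Path a b), f a b p = g a b p) :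
    f = g := by
  funext a b p; exact h a b p

@[simp] theorem add_apply (f g : CompletedPathAlgebra R V) (a b : V) (p : Quiver.Path a b) :
    (f + g) a b p = f a b p + g a b p := rfl
@[simp] theorem sub_apply (f g : CompletedPathAlgebra R V) (a b : V) (p : Quiver.Path a b) :
    (f - g) a b p = f a b p - g a b p := rfl
@[simp] theorem neg_apply (f : CompletedPathAlgebra R V) (a b : V) (p : Quiver.Path a b) :
    (-f) a b p = - f a b p := rfl
@[simp] theorem zero_apply (a b : V) (p : Quiver.Path a b) :
    (0 : CompletedPathAlgebra R V) a b p = 0 := rfl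
@[simp] theorem smul_apply (c : R) (f : CompletedPathAlgebra R V) (a b : V) (p : Quiver.Path a b) :
    (c • f) a b p = c * f a b p := rfl

theorem sum_apply {ι : Type*} (s : Finset ι) (f : ι → CompletedPathAlgebra R V) (a b : V)
    (p : Quiver.Path a b) : (∑ i ∈ s, f i) a b p = ∑ i ∈ s, f i a b p := by
  classical
  induction s using Finset.induction_on with
  | empty => simp
  | insert i s hi ih => simp [Finset.sum_insert hi, ih]

/-- The coefficient at a path of a product, for coefficients `F` of the factor that comes last
and `G` of the factor that comes first. -/
def conv {a b : V} (F : ∀ c, Quiver.Path c b → R) (G : ∀ c, Quiver.Path a c → R) (p : Quiver.Path a b) : R :=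
  ((pathSplits p).map fun s => F s.1 s.2.2 * G s.1 s.2.1).sum

theorem conv_nil {a : V} (F : ∀ c, Quiver.Path c a → R) (G : ∀ c, Quiver.Path a c → R) :
    conv F G Quiver.Path.nil = F a Quiver.Path.nil * G a Quiver.Path.nil := by
  simp [conv, pathSplits]

theorem conv_cons {a b d : V} (F : ∀ c, Quiver.Path c d → R) (G : ∀ c, Quiver.Path a c → R) (p : Quiver.Path a b)
    (e : b ⟶ d) : conv F G (p.cons e) =
      F d Quiver.Path.nil * G d (p.cons e) + conv (fun c r => F c (r.cons e)) G p := by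
  simp [conv, pathSplits, Function.comp_def]

theorem conv_add_left {a b : V} (F F' : ∀ c, Quiver.Path c b → R) (G : ∀ c, Quiver.Path a c → R)
    (p : Quiver.Path a b) : conv (fun c r => F c r + F' c r) G p = conv F G p + conv F' G p := by
  induction p with
  | nil => simp [conv_nil, add_mul]
  | cons p e ih => simp only [conv_cons, ih]; ring

theorem conv_smul_left {a b : V} (x : R) (F : ∀ c, Quiver.Path c b → R) (G : ∀ c, Quiver.Path a c → R)
    (p : Quiver.Path a b) : conv (fun c r => x * F c r) G p = x * conv F G p := by
  induction p with
  | nil => simp [conv_nil, mul_assoc]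
  | cons p e ih => simp only [conv_cons, ih]; ring

theorem conv_add_right {a b : V} (F : ∀ c, Quiver.Path c b → R) (G G' : ∀ c, Quiver.Path a c → R)
    (p : Quiver.Path a b) : conv F (fun c r => G c r + G' c r) p = conv F G p + conv F G' p := by
  induction p with
  | nil => simp [conv_nil, mul_add]
  | cons p e ih => simp only [conv_cons, ih]; ring

theorem conv_smul_right {a b : V} (x : R) (F : ∀ c, Quiver.Path c b → R) (G : ∀ c, Quiver.Path a c → R)
    (p : Quiver.Path a b) : conv F (fun c r => x * G c r) p = x * conv F G p := by
  induction p with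
  | nil => simp [conv_nil]; ring
  | cons p e ih => simp only [conv_cons, ih]; ring

theorem conv_zero_left {a b : V} (G : ∀ c, Quiver.Path a c → R) (p : Quiver.Path a b) :
    conv (fun _ _ => 0) G p = 0 := by
  simpa using conv_smul_left 0 (fun _ _ => 0) G p

theorem conv_assoc {a b : V} (F : ∀ c, Quiver.Path c b → R) (g : ∀ c d, Quiver.Path c d → R)
    (H : ∀ c, Quiver.Path a c → R) (p : Quiver.Path a b) :
    conv (fun c r => conv F (g c) r) H p =
      conv F (fun c q => conv (fun d r => g d c r) H q) p := by
  induction p with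
  | nil => simp [conv_nil, mul_assoc]
  | cons p e ih =>
    simp only [conv_cons, conv_nil, conv_add_left, conv_smul_left, ih]
    ring

/-- Multiplication is the concatenation of paths, extended bilinearly and continuously; as for the
composition of maps, `f * g` means "first `g`, then `f`", so that left modules are
(covariant) representations of the quiver. -/
instance : Mul (CompletedPathAlgebra R V) :=
  ⟨fun f g a b p => ((pathSplits p).map fun s => f s.1 b s.2.2 * g a s.1 s.2.1).sum⟩

theorem mul_apply (f g : CompletedPathAlgebra R V) (a b : V) (p : Quiver.Path a b) :
    (f * g) a b p = conv (fun c r => f c b r) (g a) p := rfl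

/-- The unit: the sum of all trivial paths. -/
instance : One (CompletedPathAlgebra R V) :=
  ⟨fun _ _ p => if p.length = 0 then 1 else 0⟩

theorem one_apply (a b : V) (p : Quiver.Path a b) :
    (1 : CompletedPathAlgebra R V) a b p = if p.length = 0 then 1 else 0 := rfl

theorem one_conv {a b : V} (G : ∀ c, Quiver.Path a c → R) (p : Quiver.Path a b) :
    conv (fun _ r => if r.length = 0 then 1 else 0) G p = G b p := by
  cases p with
  | nil => simp [conv_nil]
  | cons p e => simp [conv_cons, conv_zero_left]

theorem conv_one {a b : V} (F : ∀ c, Quiver.Path c b → R) (p : Quiver.Path a b) :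
    conv F (fun _ r => if r.length = 0 then 1 else 0) p = F a p := by
  induction p with
  | nil => simp [conv_nil]
  | cons p e ih => simp [conv_cons, ih]

instance : Ring (CompletedPathAlgebra R V) :=
  { (inferInstance : AddCommGroup (CompletedPathAlgebra R V)),
    (inferInstance : Mul (CompletedPathAlgebra R V)),
    (inferInstance : One (CompletedPathAlgebra R V)) with
    left_distrib := fun f g h => by
      ext a b p
      simp only [mul_apply, add_apply]
      exact conv_add_right _ _ _ _
    right_distrib := fun f g h => by
      ext a b p
      simp only [mul_apply, add_apply]
      exact conv_add_left _ _ _ _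
    zero_mul := fun f => by
      ext a b p
      simp only [mul_apply, zero_apply]
      exact conv_zero_left _ _
    mul_zero := fun f => by
      ext a b p
      have h := conv_smul_right 0 (fun c r => f c b r) (fun _ _ => 0) p
      simp only [zero_mul] at h
      exact h
    mul_assoc := fun f g h => by
      ext a b p
      exact conv_assoc (fun c r => f c b r) g (h a) p
    one_mul := fun f => by
      ext a b p
      exact one_conv (f a) p
    mul_one := fun f => by
      ext a b p
      exact conv_one (fun c r => f c b r) p }

instance : Algebra R (CompletedPathAlgebra R V) :=
  Algebra.ofModule
    (fun c f g => by ext a b p; exact conv_smul_left c (fun d r => f d b r) (g a) p)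
    (fun c f g => by ext a b p; exact conv_smul_right c (fun d r => f d b r) (g a) p)

open Classical in
/-- A path, as an element of the completed path algebra. -/
noncomputable def single {a b : V} (p : Quiver.Path a b) : CompletedPathAlgebra R V :=
  fun c d q => if (⟨c, d, q⟩ : Σ c d : V, Quiver.Path c d) = ⟨a, b, p⟩ then 1 else 0

theorem single_self {a b : V} (p : Quiver.Path a b) :
    (single p : CompletedPathAlgebra R V) a b p = 1 := by
  unfold single; rw [if_pos rfl]

theorem single_of_ne {a b c d : V} (p : Quiver.Path a b) (q : Quiver.Path c d)
    (h : (⟨c, d, q⟩ : Σ c d : V, Quiver.Path c d) ≠ ⟨a, b, p⟩) :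
    (single p : CompletedPathAlgebra R V) c d q = 0 := by
  unfold single; rw [if_neg h]

/-- `f` is a (possibly infinite) combination of paths of length at least `N`. For a finite quiver
this says that `f` lies in the `N`-th power of the ideal `m` generated by the arrows. -/
def VanishesBelow (N : ℕ) (f : CompletedPathAlgebra R V) : Prop :=
  ∀ (a b : V) (p : Quiver.Path a b), p.length < N → f a b p = 0

theorem length_of_mem_pathSplits {a b : V} (p : Quiver.Path a b) :
    ∀ s ∈ pathSplits p, s.2.1.length + s.2.2.length = p.length := by
  induction p with
  | nil => simp [pathSplits]
  | cons p e ih =>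
    intro s hs
    simp only [pathSplits, List.mem_cons, List.mem_map] at hs
    rcases hs with rfl | ⟨s', hs', rfl⟩
    · simp
    · have := ih s' hs'
      simp only [Quiver.Path.length_cons]
      omega

namespace VanishesBelow

variable {N M : ℕ} {f g : CompletedPathAlgebra R V}

theorem zero : VanishesBelow N (0 : CompletedPathAlgebra R V) := fun _ _ _ _ => rfl
theorem add (hf : VanishesBelow N f) (hg : VanishesBelow N g) : VanishesBelow N (f + g) :=
  fun a b p hp => by simp [hf a b p hp, hg a b p hp]
theorem neg (hf : VanishesBelow N f) : VanishesBelow N (-f) :=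
  fun a b p hp => by simp [hf a b p hp]
theorem sub (hf : VanishesBelow N f) (hg : VanishesBelow N g) : VanishesBelow N (f - g) :=
  fun a b p hp => by simp [hf a b p hp, hg a b p hp]
theorem smul (c : R) (hf : VanishesBelow N f) : VanishesBelow N (c • f) :=
  fun a b p hp => by simp [hf a b p hp]
theorem of_zero (f : CompletedPathAlgebra R V) : VanishesBelow 0 f := fun _ _ _ h => by omega
theorem mono (h : M ≤ N) (hf : VanishesBelow N f) : VanishesBelow M f :=
  fun a b p hp => hf a b p (by omega)
theorem sum {ι : Type*} (s : Finset ι) (f : ι → CompletedPathAlgebra R V)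
    (h : ∀ i ∈ s, VanishesBelow N (f i)) : VanishesBelow N (∑ i ∈ s, f i) :=
  fun a b p hp => by
    rw [sum_apply]
    exact Finset.sum_eq_zero fun i hi => h i hi a b p hp

theorem mul (hf : VanishesBelow N f) (hg : VanishesBelow M g) : VanishesBelow (N + M) (f * g) := by
  intro a b p hp
  refine List.sum_eq_zero ?_
  intro x hx
  obtain ⟨s, hs, rfl⟩ := List.mem_map.1 hx
  have h := length_of_mem_pathSplits p s hs
  by_cases h1 : s.2.2.length < N
  · simp [hf _ _ _ h1]
  · simp [hg _ _ s.2.1 (by omega)]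

theorem mul_left (f : CompletedPathAlgebra R V) (hg : VanishesBelow N g) :
    VanishesBelow N (f * g) := by
  simpa using (of_zero f).mul hg
theorem mul_right (hf : VanishesBelow N f) (g : CompletedPathAlgebra R V) :
    VanishesBelow N (f * g) := by
  simpa using hf.mul (of_zero g)
theorem pow (hf : VanishesBelow 1 f) (j : ℕ) : VanishesBelow j (f ^ j) := by
  induction j with
  | zero => exact of_zero _
  | succ j ih => rw [pow_succ]; exact ih.mul hf

theorem eq_zero (h : ∀ N, VanishesBelow N f) : f = 0 := by
  ext a b p; exact h (p.length + 1) a b p (by omega)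

end VanishesBelow

/-- The closure of a two-sided ideal in the `m`-adic topology. -/
def idealClosure (I : TwoSidedIdeal (CompletedPathAlgebra R V)) :
    TwoSidedIdeal (CompletedPathAlgebra R V) :=
  TwoSidedIdeal.mk' {f | ∀ N : ℕ, ∃ g ∈ I, VanishesBelow N (f - g)}
    (fun _ => ⟨0, I.zero_mem, by simpa using VanishesBelow.zero⟩)
    (fun {x y} hx hy N => by
      obtain ⟨g, hg, hg'⟩ := hx N
      obtain ⟨h, hh, hh'⟩ := hy N
      exact ⟨g + h, I.add_mem hg hh, by
        rw [show x + y - (g + h) = (x - g) + (y - h) by abel]; exact hg'.add hh'⟩)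
    (fun {x} hx N => by
      obtain ⟨g, hg, hg'⟩ := hx N
      exact ⟨-g, I.neg_mem hg, by rw [show -x - -g = -(x - g) by abel]; exact hg'.neg⟩)
    (fun {x y} hy N => by
      obtain ⟨g, hg, hg'⟩ := hy N
      exact ⟨x * g, I.mul_mem_left _ _ hg, by rw [← mul_sub]; exact hg'.mul_left x⟩)
    (fun {x y} hx N => by
      obtain ⟨g, hg, hg'⟩ := hx N
      exact ⟨g * y, I.mul_mem_right _ _ hg, by rw [← sub_mul]; exact hg'.mul_right y⟩)

theorem mem_idealClosure {I : TwoSidedIdeal (CompletedPathAlgebra R V)}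
    {f : CompletedPathAlgebra R V} :
    f ∈ idealClosure I ↔ ∀ N : ℕ, ∃ g ∈ I, VanishesBelow N (f - g) := by
  simp [idealClosure]

/-- The value `∑ⱼ fⱼ tʲ` of a power series `f` at an element `t` without constant term. (If `t` has
no constant term then `tʲ` involves no path of length less than `j`, so that the sum below, which
is finite at each path, is the full one.) -/
noncomputable def evalPowerSeries (t : CompletedPathAlgebra R V) (f : R⟦X⟧) : CompletedPathAlgebra R V :=
  fun a b p => ∑ j ∈ Finset.range (p.length + 1), PowerSeries.coeff j f * (t ^ j) a b p

theorem aeval_vanishesBelow {t : CompletedPathAlgebra R V} (ht : VanishesBelow 1 t) {N : ℕ}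
    {P : Polynomial R} (hP : ∀ j < N, P.coeff j = 0) : VanishesBelow N (Polynomial.aeval t P) := by
  obtain ⟨Q, rfl⟩ := Polynomial.X_pow_dvd_iff.2 hP
  rw [map_mul, map_pow, Polynomial.aeval_X]
  exact (ht.pow N).mul_right _

theorem evalPowerSeries_approx {t : CompletedPathAlgebra R V} (ht : VanishesBelow 1 t) (f : R⟦X⟧)
    (N : ℕ) : VanishesBelow N (evalPowerSeries t f - Polynomial.aeval t (PowerSeries.trunc N f)) := by
  intro a b p hp
  rw [sub_apply, sub_eq_zero, Polynomial.aeval_eq_sum_range'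
    (show (PowerSeries.trunc N f).natDegree < N by
      have := PowerSeries.natDegree_trunc_lt f (N - 1)
      rwa [Nat.sub_add_cancel (by omega)] at this), sum_apply]
  unfold evalPowerSeries
  refine Finset.sum_subset_zero_on_sdiff (Finset.range_mono hp) ?_ ?_
  · intro j hj
    simp only [Finset.mem_sdiff, Finset.mem_range, not_lt] at hj
    rw [smul_apply, ht.pow j a b p (by omega), mul_zero]
  · intro j hj
    simp only [Finset.mem_range] at hj
    rw [smul_apply, PowerSeries.coeff_trunc, if_pos (by omega)]

/-- Evaluation of power series at an element `t` without constant term, as a ring homomorphism. -/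
noncomputable def evalPowerSeriesHom (t : CompletedPathAlgebra R V) (ht : VanishesBelow 1 t) :
    R⟦X⟧ →+* CompletedPathAlgebra R V where
  toFun := evalPowerSeries t
  map_one' := by
    ext a b p
    unfold evalPowerSeries
    rw [Finset.sum_eq_single 0]
    · simp
    · intro j _ hj; simp [PowerSeries.coeff_one, hj]
    · simp
  map_zero' := by
    ext a b p
    simp [evalPowerSeries]
  map_add' f g := by
    ext a b p
    simp [evalPowerSeries, add_mul, Finset.sum_add_distrib]
  map_mul' f g := by
    rw [← sub_eq_zero]
    refine VanishesBelow.eq_zero fun N => ?_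
    set F := Polynomial.aeval t (PowerSeries.trunc N f)
    set G := Polynomial.aeval t (PowerSeries.trunc N g)
    have h1 := evalPowerSeries_approx ht (f * g) N
    have h2 := evalPowerSeries_approx ht f N
    have h3 := evalPowerSeries_approx ht g N
    have h4 : VanishesBelow N (Polynomial.aeval t
        (PowerSeries.trunc N (f * g) - PowerSeries.trunc N f * PowerSeries.trunc N g)) := by
      refine aeval_vanishesBelow ht fun j hj => ?_
      rw [Polynomial.coeff_sub, sub_eq_zero, PowerSeries.coeff_trunc, if_pos hj,
        PowerSeries.coeff_mul_eq_coeff_trunc_mul_trunc _ _ hj, ← Polynomial.coe_mul,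
        Polynomial.coeff_coe]
    rw [map_sub, map_mul (Polynomial.aeval t)] at h4
    have h5 := (h1.add h4).sub ((h2.mul_right (evalPowerSeries t g)).add (h3.mul_left F))
    convert h5 using 1
    simp only [F, mul_sub, sub_mul]
    abel

end CompletedPathAlgebra

end CompletedPathAlgebra

/-! ## The algebra `B_{k,n}` -/

namespace BoundaryAlgebra

open CompletedPathAlgebra

/-- The arrows `x i : i - 1 ⟶ i` and `y i : i ⟶ i - 1` of the double of the circular graph
with vertex set `ℤ/n`. -/
inductive Arrow (n : ℕ) : ZMod n → ZMod n → Type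
  | x (i : ZMod n) : Arrow n (i - 1) i
  | y (i : ZMod n) : Arrow n i (i - 1)

/-- The quiver `Γ_n`. -/
instance circularQuiver (n : ℕ) : Quiver (ZMod n) := ⟨Arrow n⟩

/-- The arrow `x_i : i - 1 ⟶ i` of `Γ_n`. -/
abbrev xHom {n : ℕ} (i : ZMod n) : (i - 1 : ZMod n) ⟶ i := Arrow.x i

/-- The arrow `y_i : i ⟶ i - 1` of `Γ_n`. -/
abbrev yHom {n : ℕ} (i : ZMod n) : (i : ZMod n) ⟶ i - 1 := Arrow.y i

/-- The completed path algebra of `Γ_n` over `ℂ`. -/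
abbrev PathAlg (n : ℕ) := CompletedPathAlgebra ℂ (ZMod n)

variable (k n : ℕ)

/-- The trivial path at the vertex `i`. -/
noncomputable def idem (i : ZMod n) : PathAlg n := single (Quiver.Path.nil : Quiver.Path i i)

/-- The arrow `x_i`, in the completed path algebra. -/
noncomputable def xArr (i : ZMod n) : PathAlg n :=
  single (xHom i).toPath

/-- The arrow `y_i`, in the completed path algebra. -/
noncomputable def yArr (i : ZMod n) : PathAlg n :=
  single (yHom i).toPath

variable [NeZero n]

/-- `x = ∑ x_i`. -/
noncomputable def xSum : PathAlg n := ∑ i : ZMod n, xArr n i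

/-- `y = ∑ y_i`. -/
noncomputable def ySum : PathAlg n := ∑ i : ZMod n, yArr n i

/-- `t = ∑ x_i y_i`. -/
noncomputable def tElt : PathAlg n := ∑ i : ZMod n, xArr n i * yArr n i

/-- The relations `xy - yx` and `x ^ k - y ^ (n - k)`, one of each for the paths starting at each
vertex. -/
def relations : Set (PathAlg n) :=
  {r | ∃ i : ZMod n, r = (xSum n * ySum n - ySum n * xSum n) * idem n i ∨
    r = (xSum n ^ k - ySum n ^ (n - k)) * idem n i}

/-- The closed two-sided ideal generated by the relations. -/
noncomputable def relIdeal : TwoSidedIdeal (PathAlg n) :=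
  idealClosure (TwoSidedIdeal.span (relations k n))

end BoundaryAlgebra

/-- The algebra `B_{k,n}`: the quotient of the completed path algebra of `Γ_n` by the closure of the
ideal generated by the relations `xy - yx` and `x ^ k - y ^ (n - k)` at every vertex. -/
def BoundaryAlgebra (k n : ℕ) [NeZero n] : Type :=
  (BoundaryAlgebra.relIdeal k n).ringCon.Quotient

namespace BoundaryAlgebra

open CompletedPathAlgebra

noncomputable instance (k n : ℕ) [NeZero n] : Ring (BoundaryAlgebra k n) :=
  inferInstanceAs (Ring (BoundaryAlgebra.relIdeal k n).ringCon.Quotient)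

/-- The projection from the completed path algebra to `B_{k,n}`. -/
noncomputable def proj (k n : ℕ) [NeZero n] : PathAlg n →+* BoundaryAlgebra k n :=
  (relIdeal k n).ringCon.mk'

/-! ### `ℂ[[t]]` is central in `B_{k,n}` -/

section Central

set_option linter.unusedSectionVars false

/-- Whether an arrow is one of the `x_i`. -/
def Arrow.isX {n : ℕ} {b c : ZMod n} : Arrow n b c → Bool
  | .x _ => true
  | .y _ => false

variable {k n : ℕ}

theorem idem_apply_cons {i a b c : ZMod n} (p : Quiver.Path a b) (e : b ⟶ c) :
    idem n i a c (p.cons e) = 0 :=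
  single_of_ne _ _ fun h => by cases h

theorem idem_apply_nil (i a : ZMod n) : idem n i a a Quiver.Path.nil = if a = i then 1 else 0 := by
  split_ifs with h
  · subst h; exact single_self _
  · exact single_of_ne _ _ fun h' => h (congrArg Sigma.fst h')

theorem idem_mul_apply (i : ZMod n) (g : PathAlg n) {a b : ZMod n} (p : Quiver.Path a b) :
    (idem n i * g) a b p = if b = i then g a b p else 0 := by
  rw [CompletedPathAlgebra.mul_apply]
  cases p with
  | nil => rw [conv_nil, idem_apply_nil]; simp
  | cons p e => simp [conv_cons, idem_apply_nil, idem_apply_cons, conv_zero_left]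

theorem single_toPath_mul_apply_nil {b c : ZMod n} (e : b ⟶ c) (g : PathAlg n) (a : ZMod n) :
    (single e.toPath * g : PathAlg n) a a Quiver.Path.nil = 0 := by
  rw [CompletedPathAlgebra.mul_apply, conv_nil, single_of_ne _ _ (fun h => by cases h), zero_mul]

theorem single_toPath_mul_apply_cons {b c : ZMod n} (e : b ⟶ c) (g : PathAlg n)
    (a : ZMod n) (p : Quiver.Path a b) :
    (single e.toPath * g : PathAlg n) a c (p.cons e) = g a b p := by
  rw [CompletedPathAlgebra.mul_apply, conv_cons, single_of_ne _ _ (fun h => by cases h), zero_mul, zero_add]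
  cases p with
  | nil => rw [conv_nil, show Quiver.Path.nil.cons e = e.toPath from rfl, single_self, one_mul]
  | cons p f =>
    have h2 : (fun (d : ZMod n) (r : Quiver.Path d _) =>
        (single e.toPath : PathAlg n) d c ((r.cons f).cons e)) = fun _ _ => 0 := by
      funext d r
      exact single_of_ne _ _ fun h => by cases h
    rw [conv_cons, h2, conv_zero_left, show Quiver.Path.nil.cons e = e.toPath from rfl,
      single_self, one_mul, add_zero]

theorem single_toPath_mul_apply_cons_of_ne {b c b' c' : ZMod n} (e : b ⟶ c) (g : PathAlg n)
    (a : ZMod n) (p : Quiver.Path a b') (e' : b' ⟶ c')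
    (h : (⟨b', c', e'⟩ : Σ b c : ZMod n, b ⟶ c) ≠ ⟨b, c, e⟩) :
    (single e.toPath * g : PathAlg n) a c' (p.cons e') = 0 := by
  rw [CompletedPathAlgebra.mul_apply, conv_cons, single_of_ne _ _ (fun h => by cases h), zero_mul, zero_add]
  have h1 : ∀ (d : ZMod n) (r : Quiver.Path d b'),
      (single e.toPath : PathAlg n) d c' (r.cons e') = 0 := fun d r =>
    single_of_ne _ _ fun h' => h (by cases h'; rfl)
  simp only [h1, conv_zero_left]

theorem idem_mul_idem (i j : ZMod n) : idem n i * idem n j = if i = j then idem n i else 0 := by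
  ext a b p
  rw [idem_mul_apply]
  cases p with
  | nil =>
    rw [idem_apply_nil]
    by_cases h : i = j
    · subst h; simp [idem_apply_nil]
    · rw [if_neg h, CompletedPathAlgebra.zero_apply]
      split_ifs with h1 h2
      · exact absurd (h1.symm.trans h2) h
      · rfl
      · rfl
  | cons p e =>
    rw [idem_apply_cons]
    split_ifs <;> simp [idem_apply_cons]

theorem idem_mul_single {a b : ZMod n} (p : Quiver.Path a b) (i : ZMod n) :
    idem n i * single p = if i = b then single p else 0 := by
  ext c d q
  rw [idem_mul_apply]
  by_cases h : (⟨c, d, q⟩ : Σ c d : ZMod n, Quiver.Path c d) = ⟨a, b, p⟩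
  · cases h
    split_ifs with h1 h2 h2
    · rfl
    · exact absurd h1.symm h2
    · exact absurd h2.symm h1
    · rfl
  · rw [single_of_ne _ _ h]
    split_ifs <;> simp [single_of_ne _ _ h]

theorem single_mul_idem_self {b c : ZMod n} (e : b ⟶ c) :
    (single e.toPath : PathAlg n) * idem n b = single e.toPath := by
  ext a d p
  cases p with
  | nil => rw [single_toPath_mul_apply_nil, single_of_ne _ _ fun h => by cases h]
  | @cons b' _ p e' =>
    by_cases h : (⟨b', d, e'⟩ : Σ b c : ZMod n, b ⟶ c) = ⟨b, c, e⟩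
    · cases h
      rw [single_toPath_mul_apply_cons]
      cases p with
      | nil => rw [idem_apply_nil, if_pos rfl]; exact (single_self _).symm
      | cons p f => rw [idem_apply_cons, single_of_ne _ _ fun h => by cases h]
    · rw [single_toPath_mul_apply_cons_of_ne _ _ _ _ _ h,
        single_of_ne _ _ fun h' => h (by cases h'; rfl)]

theorem single_mul_idem {b c : ZMod n} (e : b ⟶ c) (i : ZMod n) :
    (single e.toPath : PathAlg n) * idem n i = if b = i then single e.toPath else 0 := by
  rw [← single_mul_idem_self, mul_assoc, idem_mul_idem]
  split_ifs <;> simp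

theorem idem_mul_xArr (i j : ZMod n) : idem n i * xArr n j = if i = j then xArr n j else 0 :=
  idem_mul_single _ _
theorem xArr_mul_idem (i j : ZMod n) : xArr n j * idem n i = if j - 1 = i then xArr n j else 0 :=
  single_mul_idem _ _
theorem idem_mul_yArr (i j : ZMod n) : idem n i * yArr n j = if i = j - 1 then yArr n j else 0 :=
  idem_mul_single _ _
theorem yArr_mul_idem (i j : ZMod n) : yArr n j * idem n i = if j = i then yArr n j else 0 :=
  single_mul_idem _ _

theorem xArr_mul_yArr_of_ne {i j : ZMod n} (h : i ≠ j) : xArr n i * yArr n j = 0 := by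
  have h1 : xArr n i = xArr n i * idem n (i - 1) := by rw [xArr_mul_idem, if_pos rfl]
  rw [h1, mul_assoc, idem_mul_yArr, if_neg (by simpa using h), mul_zero]

variable [NeZero n]

theorem sum_idem : ∑ i : ZMod n, idem n i = 1 := by
  ext a b p
  rw [CompletedPathAlgebra.sum_apply, CompletedPathAlgebra.one_apply]
  cases p with
  | nil => simp [idem_apply_nil]
  | cons p e => simp [idem_apply_cons]

theorem tElt_eq : tElt n = xSum n * ySum n := by
  unfold tElt xSum ySum
  rw [Finset.sum_mul_sum]
  refine Finset.sum_congr rfl fun i _ => ?_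
  rw [Finset.sum_eq_single i (fun j _ hj => xArr_mul_yArr_of_ne hj.symm) (by simp)]

theorem xArr_eq (i : ZMod n) : xArr n i = xSum n * idem n (i - 1) := by
  unfold xSum
  rw [Finset.sum_mul, Finset.sum_eq_single i]
  · rw [xArr_mul_idem, if_pos rfl]
  · intro j _ hj; rw [xArr_mul_idem, if_neg (by simpa using hj)]
  · simp

theorem yArr_eq (i : ZMod n) : yArr n i = ySum n * idem n i := by
  unfold ySum
  rw [Finset.sum_mul, Finset.sum_eq_single i]
  · rw [yArr_mul_idem, if_pos rfl]
  · intro j _ hj; rw [yArr_mul_idem, if_neg hj]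
  · simp

theorem tElt_mul_idem (i : ZMod n) : tElt n * idem n i = idem n i * tElt n := by
  unfold tElt
  rw [Finset.sum_mul, Finset.mul_sum]
  refine Finset.sum_congr rfl fun j _ => ?_
  rw [mul_assoc, yArr_mul_idem, ← mul_assoc, idem_mul_xArr]
  by_cases h : j = i
  · rw [if_pos h, if_pos h.symm]
  · rw [if_neg h, if_neg (Ne.symm h), mul_zero, zero_mul]

theorem arr_vanishesBelow {b c : ZMod n} (e : b ⟶ c) :
    VanishesBelow 1 (single e.toPath : PathAlg n) := by
  intro a b p hp
  cases p with
  | nil => exact single_of_ne _ _ fun h => by cases h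
  | cons p e => simp at hp

theorem tElt_vanishesBelow : VanishesBelow 1 (tElt n) :=
  VanishesBelow.sum _ _ fun i _ => VanishesBelow.mul_right (arr_vanishesBelow (xHom i)) _

/-- The elements that commute with `u` modulo the two-sided ideal `I`. -/
def commutant (I : TwoSidedIdeal (PathAlg n)) (u : PathAlg n) : Subalgebra ℂ (PathAlg n) where
  carrier := {h | u * h - h * u ∈ I}
  mul_mem' {a b} ha hb := by
    have := I.add_mem (I.mul_mem_right _ b ha) (I.mul_mem_left a _ hb)
    rw [show (u * a - a * u) * b + a * (u * b - b * u) = u * (a * b) - a * b * u by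
      noncomm_ring] at this
    exact this
  add_mem' {a b} ha hb := by
    have := I.add_mem ha hb
    rw [show u * a - a * u + (u * b - b * u) = u * (a + b) - (a + b) * u by
      noncomm_ring] at this
    exact this
  algebraMap_mem' c := by
    simp only [Set.mem_ofPred_eq]
    rw [Algebra.commutes, sub_self]
    exact I.zero_mem

theorem mem_commutant {I : TwoSidedIdeal (PathAlg n)} {u h : PathAlg n} :
    h ∈ commutant I u ↔ u * h - h * u ∈ I := Iff.rfl

theorem mem_commutant_symm {I : TwoSidedIdeal (PathAlg n)} {u h : PathAlg n}
    (hh : h ∈ commutant I u) : u ∈ commutant I h := by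
  have := I.neg_mem (mem_commutant.1 hh)
  rwa [neg_sub] at this

variable (n) in
/-- The subalgebra of finite combinations of paths. -/
noncomputable def finiteSub : Subalgebra ℂ (PathAlg n) :=
  Algebra.adjoin ℂ ({xSum n, ySum n} ∪ Set.range (idem n))

theorem xSum_mul_ySum_mem :
    xSum n * ySum n - ySum n * xSum n ∈ TwoSidedIdeal.span (relations k n) := by
  rw [← mul_one (xSum n * ySum n - ySum n * xSum n), ← sum_idem, Finset.mul_sum]
  exact sum_mem fun i _ => TwoSidedIdeal.subset_span ⟨i, Or.inl rfl⟩

theorem finiteSub_le_commutant :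
    finiteSub n ≤ commutant (TwoSidedIdeal.span (relations k n)) (tElt n) := by
  refine Algebra.adjoin_le ?_
  rintro h ((rfl | rfl) | ⟨i, rfl⟩)
  · rw [SetLike.mem_coe, mem_commutant, tElt_eq,
      show xSum n * ySum n * xSum n - xSum n * (xSum n * ySum n) =
        -(xSum n * (xSum n * ySum n - ySum n * xSum n)) by noncomm_ring]
    exact TwoSidedIdeal.neg_mem _ (TwoSidedIdeal.mul_mem_left _ _ _ xSum_mul_ySum_mem)
  · rw [SetLike.mem_coe, mem_commutant, tElt_eq,
      show xSum n * ySum n * ySum n - ySum n * (xSum n * ySum n) =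
        (xSum n * ySum n - ySum n * xSum n) * ySum n by noncomm_ring]
    exact TwoSidedIdeal.mul_mem_right _ _ _ xSum_mul_ySum_mem
  · rw [SetLike.mem_coe, mem_commutant, tElt_mul_idem, sub_self]
    exact TwoSidedIdeal.zero_mem _

open Classical in
/-- The coefficients of `g` at the paths whose last arrow is `e`. -/
noncomputable def lastArrowPart {b c : ZMod n} (e : b ⟶ c) (g : PathAlg n) : PathAlg n :=
  fun a d q => if h : d = b then g a c ((h ▸ q).cons e) else 0

theorem lastArrowPart_apply {b c : ZMod n} (e : b ⟶ c) (g : PathAlg n) (a : ZMod n)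
    (q : Quiver.Path a b) : lastArrowPart e g a b q = g a c (q.cons e) := by
  simp [lastArrowPart]

theorem decompose (g : PathAlg n) :
    g = ∑ i : ZMod n, (g i i Quiver.Path.nil • idem n i +
      (xArr n i * lastArrowPart (xHom i) g +
        yArr n i * lastArrowPart (yHom i) g)) := by
  ext a b p
  rw [CompletedPathAlgebra.sum_apply]
  simp only [CompletedPathAlgebra.add_apply, CompletedPathAlgebra.smul_apply]
  cases p with
  | nil =>
    rw [Finset.sum_eq_single a]
    · rw [idem_apply_nil, if_pos rfl, xArr, yArr, single_toPath_mul_apply_nil,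
        single_toPath_mul_apply_nil]
      simp
    · intro j _ hj
      rw [idem_apply_nil, if_neg hj.symm, xArr, yArr, single_toPath_mul_apply_nil,
        single_toPath_mul_apply_nil]
      simp
    · simp
  | @cons c _ p e =>
    simp only [idem_apply_cons, mul_zero, zero_add, Finset.sum_add_distrib]
    change Arrow n c b at e
    cases e with
    | x j =>
      rw [Finset.sum_eq_single b, Finset.sum_eq_zero, add_zero]
      · exact ((single_toPath_mul_apply_cons _ _ _ _).trans (lastArrowPart_apply _ _ _ _)).symm
      · intro i _
        exact single_toPath_mul_apply_cons_of_ne _ _ _ _ _ fun h =>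
          absurd (congrArg (fun s => Arrow.isX (n := n) s.2.2) h) (by simp [Arrow.isX])
      · intro i _ hi
        exact single_toPath_mul_apply_cons_of_ne _ _ _ _ _ fun h =>
          hi (congrArg (fun s => s.2.1) h).symm
      · simp
    | y j =>
      rw [Finset.sum_eq_zero, Finset.sum_eq_single c, zero_add]
      · exact ((single_toPath_mul_apply_cons _ _ _ _).trans (lastArrowPart_apply _ _ _ _)).symm
      · intro i _ hi
        exact single_toPath_mul_apply_cons_of_ne _ _ _ _ _ fun h =>
          hi (congrArg (fun s => s.1) h).symm
      · simp
      · intro i _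
        exact single_toPath_mul_apply_cons_of_ne _ _ _ _ _ fun h =>
          absurd (congrArg (fun s => Arrow.isX (n := n) s.2.2) h) (by simp [Arrow.isX])

theorem xArr_mem (i : ZMod n) : xArr n i ∈ finiteSub n := by
  rw [xArr_eq]
  exact mul_mem (Algebra.subset_adjoin (by simp)) (Algebra.subset_adjoin (by simp))

theorem yArr_mem (i : ZMod n) : yArr n i ∈ finiteSub n := by
  rw [yArr_eq]
  exact mul_mem (Algebra.subset_adjoin (by simp)) (Algebra.subset_adjoin (by simp))

theorem exists_approx (N : ℕ) (g : PathAlg n) : ∃ h ∈ finiteSub n, VanishesBelow N (g - h) := by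
  induction N generalizing g with
  | zero => exact ⟨0, zero_mem _, VanishesBelow.of_zero _⟩
  | succ N ih =>
    choose F hF hF' using ih
    refine ⟨∑ i : ZMod n, (g i i Quiver.Path.nil • idem n i +
      (xArr n i * F (lastArrowPart (xHom i) g) +
        yArr n i * F (lastArrowPart (yHom i) g))),
      sum_mem fun i _ => add_mem (Subalgebra.smul_mem _ (Algebra.subset_adjoin (by simp)) _)
        (add_mem (mul_mem (xArr_mem i) (hF _)) (mul_mem (yArr_mem i) (hF _))), ?_⟩
    nth_rewrite 1 [decompose g]
    rw [← Finset.sum_sub_distrib]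
    refine VanishesBelow.sum _ _ fun i _ => ?_
    rw [add_sub_add_left_eq_sub, add_sub_add_comm, ← mul_sub, ← mul_sub, add_comm N 1]
    exact ((arr_vanishesBelow _).mul (hF' _)).add ((arr_vanishesBelow _).mul (hF' _))

theorem evalPowerSeries_commutes (f : ℂ⟦X⟧) (g : PathAlg n) :
    evalPowerSeries (tElt n) f * g - g * evalPowerSeries (tElt n) f ∈ relIdeal k n := by
  refine mem_idealClosure.2 fun N => ?_
  obtain ⟨h, hh, hgh⟩ := exists_approx N g
  set P := Polynomial.aeval (tElt n) (PowerSeries.trunc N f) with hP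
  have hf := evalPowerSeries_approx (tElt_vanishesBelow (n := n)) f N
  rw [← hP] at hf
  refine ⟨P * h - h * P, ?_, ?_⟩
  · have h1 : tElt n ∈ commutant (TwoSidedIdeal.span (relations k n)) h :=
      mem_commutant_symm (finiteSub_le_commutant hh)
    have h2 : P ∈ commutant (TwoSidedIdeal.span (relations k n)) h :=
      Algebra.adjoin_le (Set.singleton_subset_iff.2 h1)
        (Polynomial.aeval_mem_adjoin_singleton ℂ (tElt n))
    exact mem_commutant_symm h2
  · have h3 := ((hf.mul_right g).add (hgh.mul_left P)).sub
      ((hf.mul_left g).add (hgh.mul_right P))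
    convert h3 using 1
    noncomm_ring

variable (k n) in
/-- The map `ℂ[[t]] → B_{k,n}` that sends `t` to `∑ x_i y_i`. -/
noncomputable def centreHom : ℂ⟦X⟧ →+* BoundaryAlgebra k n :=
  (proj k n).comp (evalPowerSeriesHom (tElt n) tElt_vanishesBelow)

theorem centreHom_commutes (f : ℂ⟦X⟧) (b : BoundaryAlgebra k n) :
    centreHom k n f * b = b * centreHom k n f := by
  obtain ⟨g, rfl⟩ : ∃ g, proj k n g = b := (relIdeal k n).ringCon.mk'_surjective b
  change proj k n _ * proj k n g = proj k n g * proj k n _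
  rw [← map_mul, ← map_mul]
  exact (RingCon.eq _).2 ((TwoSidedIdeal.rel_iff _ _ _).2 (evalPowerSeries_commutes f g))

/-- `B_{k,n}` as an algebra over its centre `Z = ℂ[[t]]`, where `t = ∑ x_i y_i`. -/
noncomputable instance (k n : ℕ) [NeZero n] : Algebra ℂ⟦X⟧ (BoundaryAlgebra k n) :=
  (centreHom k n).toAlgebra' centreHom_commutes

end Central

/-! ### Cohen-Macaulay modules and their rank

The action of `Z = ℂ[[t]]` on a `B_{k,n}`-module `M` is the one through the algebra map
`Z → B_{k,n}`; this is what `IsScalarTower ℂ⟦X⟧ (BoundaryAlgebra k n) M` says. -/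

section Modules

variable (k n : ℕ) [NeZero n] (M : Type u) [AddCommGroup M] [Module (BoundaryAlgebra k n) M]
  [Module ℂ⟦X⟧ M] [IsScalarTower ℂ⟦X⟧ (BoundaryAlgebra k n) M]

/-- A (maximal) Cohen-Macaulay `B_{k,n}`-module is a module that is free of finite rank
over `Z = ℂ[[t]]`. -/
def IsCohenMacaulay (k n : ℕ) [NeZero n] (M : Type u) [AddCommGroup M]
    [Module (BoundaryAlgebra k n) M] [Module ℂ⟦X⟧ M] [IsScalarTower ℂ⟦X⟧ (BoundaryAlgebra k n) M] :
    Prop :=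
  Module.Finite ℂ⟦X⟧ M ∧ Module.Free ℂ⟦X⟧ M

/-- The field of fractions `K` of `Z`. -/
abbrev FracField : Type := FractionRing ℂ⟦X⟧

/-- The action of `K ⊗ B` on `K ⊗ M`: `(c ⊗ b) (d ⊗ m) = (c d) ⊗ (b m)`. -/
noncomputable def genericAction :
    FracField ⊗[ℂ⟦X⟧] BoundaryAlgebra k n →+* Module.End ℂ⟦X⟧ (FracField ⊗[ℂ⟦X⟧] M) :=
  ((Module.endTensorEndAlgHom (R := ℂ⟦X⟧) (S := ℂ⟦X⟧) (A := ℂ⟦X⟧) (M := FracField)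
    (N := M)).comp (Algebra.TensorProduct.map (Algebra.lsmul ℂ⟦X⟧ ℂ⟦X⟧ FracField)
      (Algebra.lsmul ℂ⟦X⟧ ℂ⟦X⟧ M))).toRingHom

theorem genericAction_tmul (c d : FracField) (b : BoundaryAlgebra k n) (m : M) :
    genericAction k n M (c ⊗ₜ b) (d ⊗ₜ m) = (c * d) ⊗ₜ (b • m) := by
  simp only [genericAction]
  rfl

/-- `K ⊗ M` as a module over `K ⊗ B`. -/
noncomputable abbrev genericModule :
    Module (FracField ⊗[ℂ⟦X⟧] BoundaryAlgebra k n) (FracField ⊗[ℂ⟦X⟧] M) :=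
  Module.compHom _ (genericAction k n M)

/-- The rank of a `B_{k,n}`-module `M`: the length of the `K ⊗ B`-module `K ⊗ M`. -/
noncomputable def rank : ℕ∞ :=
  letI := genericModule k n M
  Module.length (FracField ⊗[ℂ⟦X⟧] BoundaryAlgebra k n) (FracField ⊗[ℂ⟦X⟧] M)

end Modules

end BoundaryAlgebra

/-- A module is indecomposable if it is nonzero and is not the direct sum of two nonzero
submodules. -/
def IsIndecomposableModule (A : Type*) [Ring A] (M : Type*) [AddCommGroup M] [Module A M] : Prop :=
  Nontrivial M ∧ ∀ N P : Submodule A M, IsCompl N P → N = ⊥ ∨ P = ⊥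

/-! In `B_{k,n}` one has `xy = yx = t`, `x ^ n = t ^ (n - k)` and `y ^ n = t ^ k`. Let `M` be
Cohen–Macaulay and `F = e₀M`. After inverting `t` both `x` and `y` are invertible, so a generic
submodule is determined by its part at the vertex `0`, and every subspace there occurs; hence the
rank of `M` is the rank of the free `ℂ[[t]]`-module `F` (`rank_eq_finrank_vertexModule`).

Multiplication by `x ^ j` is injective and embeds `e₋ⱼM` in `F`, with image `Lⱼ = e₀ x ^ j M`. Thus
`M` is encoded by the decreasing chain of the `Lⱼ`, `j < n`, all of which contain `t ^ (n - k) F`.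
Exchanging `x` and `y` replaces `n - k` by `k`, and `n < 6` forces one of the two to be at most `2`.
So the chain may be taken between `t² F` and `F`.

In rank two such a chain always splits along a basis `u, v` of `F` (`exists_isBasisPair_of_chain`):
up to multiples of `t` it involves at most two lines of the plane `F/tF`. The vectors of `M` whose
translates at the vertex `0` lie in `Ru`, respectively `Rv`, then give complementary summands
(`IsCircularAction.exists_isCompl`). These are `B_{k,n}`-submodules, not just stable under the
generators, because `ℂ[[t]]`-submodules of `M` are `t`-adically closed (`smul_mem_of_stable`). -/

namespace BoundaryAlgebra

open CompletedPathAlgebra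

variable {k n : ℕ} [NeZero n]

/-! ### Relations between the generators of `B_{k,n}`. -/

theorem idem_mul_xSum (i : ZMod n) : idem n i * xSum n = xArr n i := by
  unfold xSum
  rw [Finset.mul_sum, Finset.sum_eq_single i]
  · rw [idem_mul_xArr, if_pos rfl]
  · intro j _ hj; rw [idem_mul_xArr, if_neg hj.symm]
  · simp

theorem idem_mul_ySum (i : ZMod n) : idem n i * ySum n = yArr n (i + 1) := by
  unfold ySum
  rw [Finset.mul_sum, Finset.sum_eq_single (i + 1)]
  · rw [idem_mul_yArr, if_pos (by simp)]
  · intro j _ hj; rw [idem_mul_yArr, if_neg (by rintro rfl; simp at hj)]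
  · simp

theorem xSum_mul_idem (i : ZMod n) : xSum n * idem n i = idem n (i + 1) * xSum n := by
  rw [idem_mul_xSum, xArr_eq, add_sub_cancel_right]

theorem ySum_mul_idem (i : ZMod n) : ySum n * idem n (i + 1) = idem n i * ySum n := by
  rw [idem_mul_ySum, yArr_eq]

theorem proj_eq_of_sub_mem {f g : PathAlg n}
    (h : f - g ∈ TwoSidedIdeal.span (relations k n)) : proj k n f = proj k n g :=
  (RingCon.eq _).2 ((TwoSidedIdeal.rel_iff _ _ _).2
    (mem_idealClosure.2 fun _ => ⟨_, h, by simpa using VanishesBelow.zero⟩))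

theorem proj_surjective : Function.Surjective (proj k n) :=
  (relIdeal k n).ringCon.mk'_surjective

theorem xSum_pow_sub_ySum_pow_mem :
    xSum n ^ k - ySum n ^ (n - k) ∈ TwoSidedIdeal.span (relations k n) := by
  rw [← mul_one (xSum n ^ k - ySum n ^ (n - k)), ← sum_idem, Finset.mul_sum]
  exact sum_mem fun i _ => TwoSidedIdeal.subset_span ⟨i, Or.inr rfl⟩

theorem evalPowerSeries_X : evalPowerSeries (tElt n) (PowerSeries.X : ℂ⟦X⟧) = tElt n := by
  ext a b p
  unfold evalPowerSeries
  rw [Finset.sum_eq_single 1]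
  · simp
  · intro j _ hj; simp [PowerSeries.coeff_X, hj]
  · intro h
    rw [pow_one, tElt_vanishesBelow a b p (by simpa using h), mul_zero]

theorem evalPowerSeries_C (c : ℂ) :
    evalPowerSeries (tElt n) (PowerSeries.C c) = algebraMap ℂ (PathAlg n) c := by
  rw [Algebra.algebraMap_eq_smul_one]
  ext a b p
  unfold evalPowerSeries
  rw [Finset.sum_eq_single 0]
  · simp
  · intro j _ hj; simp [PowerSeries.coeff_C, hj]
  · simp

theorem algebraMap_X :
    algebraMap ℂ⟦X⟧ (BoundaryAlgebra k n) PowerSeries.X = proj k n (tElt n) :=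
  congrArg (proj k n) evalPowerSeries_X

theorem algebraMap_C (c : ℂ) :
    algebraMap ℂ⟦X⟧ (BoundaryAlgebra k n) (PowerSeries.C c) =
      proj k n (algebraMap ℂ (PathAlg n) c) :=
  congrArg (proj k n) (evalPowerSeries_C c)

theorem proj_xSum_mul_proj_ySum :
    proj k n (xSum n) * proj k n (ySum n) = algebraMap ℂ⟦X⟧ _ PowerSeries.X := by
  rw [algebraMap_X, tElt_eq, map_mul]

theorem proj_ySum_mul_proj_xSum :
    proj k n (ySum n) * proj k n (xSum n) = algebraMap ℂ⟦X⟧ _ PowerSeries.X := by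
  rw [← proj_xSum_mul_proj_ySum, ← map_mul, ← map_mul]
  exact (proj_eq_of_sub_mem xSum_mul_ySum_mem).symm

theorem commute_proj_xSum_proj_ySum : Commute (proj k n (xSum n)) (proj k n (ySum n)) :=
  proj_xSum_mul_proj_ySum.trans proj_ySum_mul_proj_xSum.symm

theorem proj_xSum_pow : proj k n (xSum n) ^ k = proj k n (ySum n) ^ (n - k) := by
  rw [← map_pow, ← map_pow]
  exact proj_eq_of_sub_mem xSum_pow_sub_ySum_pow_mem

/-- `t ^ (n - k) = y ^ (n - k) x ^ (n - k) = x ^ k x ^ (n - k)`. -/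
theorem proj_xSum_pow_card (hkn : k ≤ n) :
    proj k n (xSum n) ^ n = algebraMap ℂ⟦X⟧ _ PowerSeries.X ^ (n - k) := by
  rw [← proj_ySum_mul_proj_xSum, commute_proj_xSum_proj_ySum.symm.mul_pow, ← proj_xSum_pow,
    ← pow_add, Nat.add_sub_cancel' hkn]

theorem proj_ySum_pow_card (hkn : k ≤ n) :
    proj k n (ySum n) ^ n = algebraMap ℂ⟦X⟧ _ PowerSeries.X ^ k := by
  rw [← proj_xSum_mul_proj_ySum, commute_proj_xSum_proj_ySum.mul_pow, proj_xSum_pow,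
    ← pow_add, Nat.sub_add_cancel hkn]

/-! ### Approximation of elements of `B_{k,n}` modulo powers of `t`. -/

omit [NeZero n] in
theorem lastArrowPart_vanishesBelow {b c : ZMod n} (e : b ⟶ c) {N : ℕ} {g : PathAlg n}
    (hg : VanishesBelow (N + 1) g) : VanishesBelow N (lastArrowPart e g) := by
  intro a d q hq
  unfold lastArrowPart
  split_ifs with h
  · subst h
    exact hg _ _ _ (by simpa using hq)
  · rfl

/-- The right ideal of `B_{k,n}` spanned by the monomials of degree `N` in `x` and `y`. -/
noncomputable def monomialIdeal (k n : ℕ) [NeZero n] (N : ℕ) : AddSubgroup (BoundaryAlgebra k n) :=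
  AddSubgroup.closure
    {z | ∃ a b c, a + b = N ∧ z = proj k n (xSum n) ^ a * proj k n (ySum n) ^ b * c}

theorem proj_xSum_mul_mem_monomialIdeal {N : ℕ} {z : BoundaryAlgebra k n}
    (hz : z ∈ monomialIdeal k n N) : proj k n (xSum n) * z ∈ monomialIdeal k n (N + 1) := by
  induction hz using AddSubgroup.closure_induction with
  | mem z hz =>
    obtain ⟨a, b, c, h, rfl⟩ := hz
    refine AddSubgroup.subset_closure ⟨a + 1, b, c, by omega, ?_⟩
    rw [pow_succ']; simp only [mul_assoc]
  | zero => simp [zero_mem]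
  | add z w _ _ hz hw => rw [mul_add]; exact add_mem hz hw
  | neg z _ hz => rw [mul_neg]; exact neg_mem hz

theorem proj_ySum_mul_mem_monomialIdeal {N : ℕ} {z : BoundaryAlgebra k n}
    (hz : z ∈ monomialIdeal k n N) : proj k n (ySum n) * z ∈ monomialIdeal k n (N + 1) := by
  induction hz using AddSubgroup.closure_induction with
  | mem z hz =>
    obtain ⟨a, b, c, h, rfl⟩ := hz
    refine AddSubgroup.subset_closure ⟨a, b + 1, c, by omega, ?_⟩
    rw [← mul_assoc, ← mul_assoc, (commute_proj_xSum_proj_ySum.symm.pow_right a).eq, pow_succ',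
      mul_assoc (_ ^ a)]
  | zero => simp [zero_mem]
  | add z w _ _ hz hw => rw [mul_add]; exact add_mem hz hw
  | neg z _ hz => rw [mul_neg]; exact neg_mem hz

/-- Peeling off last arrows turns an infinite combination of long paths into a finite sum of terms
`x * f` and `y * f'`, with `f` and `f'` vanishing below one degree less. -/
theorem proj_mem_monomialIdeal {N : ℕ} {g : PathAlg n} (hg : VanishesBelow N g) :
    proj k n g ∈ monomialIdeal k n N := by
  induction N generalizing g with
  | zero => exact AddSubgroup.subset_closure ⟨0, 0, proj k n g, rfl, by simp⟩
  | succ N ih =>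
    rw [decompose g, map_sum]
    refine sum_mem fun i _ => ?_
    rw [hg i i Quiver.Path.nil (by simp), zero_smul, zero_add, map_add, xArr_eq, yArr_eq,
      mul_assoc, mul_assoc, map_mul, map_mul _ (ySum n)]
    exact add_mem
      (proj_xSum_mul_mem_monomialIdeal (ih ((lastArrowPart_vanishesBelow _ hg).mul_left _)))
      (proj_ySum_mul_mem_monomialIdeal (ih ((lastArrowPart_vanishesBelow _ hg).mul_left _)))

theorem pow_mul_dvd {u w : BoundaryAlgebra k n} {m : ℕ} (hm : 0 < m)
    (hu : u ^ n = algebraMap ℂ⟦X⟧ _ PowerSeries.X ^ m) {a j : ℕ} (ha : n * j ≤ a) :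
    ∃ b, u ^ a * w = algebraMap ℂ⟦X⟧ _ PowerSeries.X ^ j * b := by
  refine ⟨algebraMap ℂ⟦X⟧ _ PowerSeries.X ^ (m * j - j) * (u ^ (a - n * j) * w), ?_⟩
  rw [← mul_assoc, ← pow_add, Nat.add_sub_cancel' (Nat.le_mul_of_pos_left j hm), pow_mul, ← hu,
    ← pow_mul, ← mul_assoc, ← pow_add, Nat.add_sub_cancel' ha]

/-- In a monomial of degree `2nj` one of the two exponents is at least `nj`, and `0 < k < n` makes
both `x ^ n` and `y ^ n` multiples of `t`. This compares the arrow-adic topology with the `t`-adic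
one. -/
theorem exists_eq_pow_mul_of_mem_monomialIdeal (hk : 0 < k) (hkn : k < n) (j : ℕ)
    {z : BoundaryAlgebra k n} (hz : z ∈ monomialIdeal k n (2 * (n * j))) :
    ∃ b, z = algebraMap ℂ⟦X⟧ _ PowerSeries.X ^ j * b := by
  induction hz using AddSubgroup.closure_induction with
  | mem z hz =>
    obtain ⟨a, b, c, h, rfl⟩ := hz
    rcases le_or_gt (n * j) a with ha | ha
    · rw [mul_assoc]
      exact pow_mul_dvd (Nat.sub_pos_of_lt hkn) (proj_xSum_pow_card hkn.le) ha
    · rw [(commute_proj_xSum_proj_ySum.pow_pow a b).eq, mul_assoc]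
      exact pow_mul_dvd hk (proj_ySum_pow_card hkn.le) (by omega)
  | zero => exact ⟨0, by simp⟩
  | add z w _ _ hz hw =>
    obtain ⟨⟨b, rfl⟩, c, rfl⟩ := And.intro hz hw
    exact ⟨b + c, by rw [mul_add]⟩
  | neg z _ hz =>
    obtain ⟨b, rfl⟩ := hz
    exact ⟨-b, by rw [mul_neg]⟩

/-- Every element of `B_{k,n}` is a finite combination of paths, up to a multiple of `t ^ j`. -/
theorem exists_finiteSub_approx (hk : 0 < k) (hkn : k < n) (b : BoundaryAlgebra k n) (j : ℕ) :
    ∃ h ∈ finiteSub n, ∃ c, b = proj k n h + algebraMap ℂ⟦X⟧ _ (PowerSeries.X ^ j) * c := by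
  obtain ⟨g, rfl⟩ := proj_surjective b
  obtain ⟨h, hh, hgh⟩ := exists_approx (2 * (n * j)) g
  obtain ⟨c, hc⟩ :=
    exists_eq_pow_mul_of_mem_monomialIdeal hk hkn j (proj_mem_monomialIdeal (k := k) hgh)
  exact ⟨h, hh, c, by rw [map_pow, ← hc, map_sub, add_sub_cancel]⟩

/-! ### Closedness of `ℂ[[t]]`-submodules. -/

section Modules

variable {M : Type u} [AddCommGroup M] [Module (BoundaryAlgebra k n) M]
  [Module ℂ⟦X⟧ M] [IsScalarTower ℂ⟦X⟧ (BoundaryAlgebra k n) M]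

theorem proj_smul_mem_of_mem_finiteSub {N : Submodule ℂ⟦X⟧ M}
    (he : ∀ i, ∀ m ∈ N, proj k n (idem n i) • m ∈ N)
    (hx : ∀ m ∈ N, proj k n (xSum n) • m ∈ N) (hy : ∀ m ∈ N, proj k n (ySum n) • m ∈ N)
    {h : PathAlg n} (hh : h ∈ finiteSub n) : ∀ m ∈ N, proj k n h • m ∈ N := by
  induction hh using Algebra.adjoin_induction with
  | mem h hh =>
    rcases hh with (rfl | rfl) | ⟨i, rfl⟩
    exacts [hx, hy, he i]
  | algebraMap c =>
    intro m hm
    rw [← algebraMap_C, algebraMap_smul]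
    exact N.smul_mem _ hm
  | add g h _ _ hg hh =>
    intro m hm
    rw [map_add, add_smul]
    exact N.add_mem (hg m hm) (hh m hm)
  | mul g h _ _ hg hh =>
    intro m hm
    rw [map_mul, mul_smul]
    exact hg _ (hh m hm)

/-- In a module that is finite over `ℂ[[t]]`, every `ℂ[[t]]`-submodule is closed, so that it is a
`B_{k,n}`-submodule as soon as it is stable under the generators of `B_{k,n}`. -/
theorem smul_mem_of_stable (hk : 0 < k) (hkn : k < n) [Module.Finite ℂ⟦X⟧ M]
    {N : Submodule ℂ⟦X⟧ M} (he : ∀ i, ∀ m ∈ N, proj k n (idem n i) • m ∈ N)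
    (hx : ∀ m ∈ N, proj k n (xSum n) • m ∈ N) (hy : ∀ m ∈ N, proj k n (ySum n) • m ∈ N)
    (b : BoundaryAlgebra k n) {m : M} (hm : m ∈ N) : b • m ∈ N := by
  have hI : Ideal.span {(PowerSeries.X : ℂ⟦X⟧)} ≠ ⊤ := by
    rw [Ne, Ideal.span_singleton_eq_top]
    exact PowerSeries.X_prime.not_isUnit
  -- Krull's intersection theorem in `M ⧸ N`: it suffices that the class of `b • m` is divisible by
  -- every `t ^ j`, which follows by approximating `b` by finite combinations of paths.
  have h := Ideal.iInf_pow_smul_eq_bot_of_isLocalRing (M := M ⧸ N) _ hI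
  rw [← Submodule.Quotient.mk_eq_zero, ← Submodule.mem_bot ℂ⟦X⟧, ← h, Submodule.mem_iInf]
  intro j
  obtain ⟨h, hh, c, rfl⟩ := exists_finiteSub_approx hk hkn b j
  rw [add_smul, mul_smul, algebraMap_smul, Submodule.Quotient.mk_add,
    (Submodule.Quotient.mk_eq_zero N).2 (proj_smul_mem_of_mem_finiteSub he hx hy hh m hm),
    zero_add, Submodule.Quotient.mk_smul, Ideal.span_singleton_pow]
  exact Submodule.smul_mem_smul (Ideal.mem_span_singleton_self _) trivial

end Modules

end BoundaryAlgebra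

/-! ### Circular actions and submodules spread from the vertex `0`. -/

/-- Operators `e i`, `x`, `y` on a module that satisfy the relations of the quiver `Γ_n`, with `xy`
the multiplication by `t` and `x ^ n` the multiplication by `t ^ m`. -/
structure IsCircularAction {n : ℕ} [NeZero n] {R M : Type*} [CommRing R] [AddCommGroup M]
    [Module R M] (t : R) (m : ℕ) (e : ZMod n → Module.End R M) (x y : Module.End R M) : Prop where
  idem_mul_idem : ∀ i j, e i * e j = if i = j then e i else 0
  sum_idem : ∑ i, e i = 1
  x_mul_idem : ∀ i, x * e i = e (i + 1) * x
  y_mul_idem : ∀ i, y * e (i + 1) = e i * y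
  x_mul_y : ∀ v, x (y v) = t • v
  y_mul_x : ∀ v, y (x v) = t • v
  x_pow : ∀ v, (x ^ n) v = t ^ m • v

namespace IsCircularAction

variable {n : ℕ} [NeZero n] {R M : Type*} [CommRing R] [AddCommGroup M] [Module R M] {t : R}
  {m : ℕ} {e : ZMod n → Module.End R M} {x y : Module.End R M}

/-- The vectors whose translates to the vertex `0` along `x` all lie in `U`. -/
def spread (e : ZMod n → Module.End R M) (x : Module.End R M) (U : Submodule R M) :
    Submodule R M :=
  ⨅ j : ℕ, U.comap (e 0 * x ^ j)

omit [NeZero n] in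
theorem mem_spread {U : Submodule R M} {v : M} :
    v ∈ spread e x U ↔ ∀ j : ℕ, e 0 ((x ^ j) v) ∈ U := by
  simp [spread]

omit [NeZero n] in
theorem x_mem_spread {U : Submodule R M} {v : M} (hv : v ∈ spread e x U) : x v ∈ spread e x U :=
  mem_spread.2 fun j => by simpa [pow_succ] using mem_spread.1 hv (j + 1)

omit [NeZero n] in
theorem spread_mono {U U' : Submodule R M} (h : U ≤ U') : spread e x U ≤ spread e x U' :=
  fun _ hv => mem_spread.2 fun j => h (mem_spread.1 hv j)

theorem exists_eq_neg_natCast (i : ZMod n) : ∃ j : ℕ, j < n ∧ i = -(j : ZMod n) :=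
  ⟨(-i).val, ZMod.val_lt _, by simp⟩

variable (h : IsCircularAction t m e x y)
include h

/-- Exchanging `x` and `y` reverses the orientation of the circle, whence the relabelling of the
vertices by `i ↦ -i`. -/
theorem swap {m' : ℕ} (hy : ∀ v, (y ^ n) v = t ^ m' • v) :
    IsCircularAction t m' (fun i => e (-i)) y x where
  idem_mul_idem i j := by simp only [h.idem_mul_idem, neg_inj]
  sum_idem := by rw [← h.sum_idem]; exact Equiv.sum_comp (Equiv.neg _) e
  x_mul_idem i := by
    have := h.y_mul_idem (-(i + 1))
    rwa [show -(i + 1) + 1 = -i by ring] at this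
  y_mul_idem i := by
    rw [h.x_mul_idem, show -(i + 1) + 1 = -i by ring]
  x_mul_y := h.y_mul_x
  y_mul_x := h.x_mul_y
  x_pow := hy

theorem idem_apply (i j : ZMod n) (v : M) : e i (e j v) = if i = j then e i v else 0 := by
  rw [← Module.End.mul_apply, h.idem_mul_idem]
  split_ifs <;> simp

theorem idem_apply_self (i : ZMod n) (v : M) : e i (e i v) = e i v := by
  rw [h.idem_apply, if_pos rfl]

theorem sum_idem_apply (v : M) : ∑ i, e i v = v := by
  simpa using congrArg (fun f : Module.End R M => f v) h.sum_idem

theorem x_pow_idem (j : ℕ) (i : ZMod n) (v : M) :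
    (x ^ j) (e i v) = e (i + j) ((x ^ j) v) := by
  induction j with
  | zero => simp
  | succ j ih =>
    rw [pow_succ', Module.End.mul_apply, ih, ← Module.End.mul_apply, h.x_mul_idem]
    simp [add_assoc]

/-- Only the component at the vertex `-j` reaches the vertex `0` after `j` steps; this identifies `e
(-j)` of the module with its image in the vertex `0`. -/
theorem idem_zero_x_pow (j : ℕ) (v : M) : e 0 ((x ^ j) v) = (x ^ j) (e (-j) v) := by
  rw [h.x_pow_idem, neg_add_cancel]

theorem y_pow_x_pow (j : ℕ) (v : M) : (y ^ j) ((x ^ j) v) = t ^ j • v := by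
  induction j generalizing v with
  | zero => simp
  | succ j ih =>
    rw [pow_succ y, pow_succ' x, Module.End.mul_apply, Module.End.mul_apply, h.y_mul_x, map_smul,
      ih, smul_smul, ← pow_succ']

theorem x_pow_mul (q : ℕ) (v : M) : (x ^ (n * q)) v = t ^ (m * q) • v := by
  induction q with
  | zero => simp
  | succ q ih =>
    rw [Nat.mul_succ, pow_add, Module.End.mul_apply, h.x_pow, map_smul, ih, smul_smul, ← pow_add,
      Nat.mul_succ, add_comm]

theorem x_pow_injective (ht : ∀ v : M, t • v = 0 → v = 0) (j : ℕ) {v : M}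
    (hv : (x ^ j) v = 0) : v = 0 := by
  have h1 := h.y_pow_x_pow j v
  rw [hv, map_zero] at h1
  clear hv
  induction j with
  | zero => simpa using h1.symm
  | succ j ih => exact ih (ht _ (by rw [smul_smul, ← pow_succ', ← h1])).symm

theorem idem_mem_spread {U : Submodule R M} {v : M} (hv : v ∈ spread e x U) (i : ZMod n) :
    e i v ∈ spread e x U :=
  mem_spread.2 fun j => by
    rw [h.idem_zero_x_pow, h.idem_apply]
    split_ifs
    · rw [← h.idem_zero_x_pow]
      exact mem_spread.1 hv _
    · simp

/-- Since `xy = t`, every positive power of `x` sends `y v` back to a multiple of a translate of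
`v`. The power `0` is reached from `x ^ n = t ^ m` by cancelling `t ^ m`, which is where the
saturation of `U` at the vertex `0` enters. -/
theorem y_mem_spread {U : Submodule R M} (hU : ∀ v, e 0 v = v → t • v ∈ U → v ∈ U) {v : M}
    (hv : v ∈ spread e x U) : y v ∈ spread e x U := by
  have key : ∀ j : ℕ, e 0 ((x ^ (j + 1)) (y v)) ∈ U := fun j => by
    rw [pow_succ, Module.End.mul_apply, h.x_mul_y, map_smul, map_smul]
    exact U.smul_mem _ (mem_spread.1 hv _)
  have hpow : ∀ (l : ℕ) (w : M), e 0 w = w → t ^ l • w ∈ U → w ∈ U := fun l => by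
    induction l with
    | zero => intro w _ hw; simpa using hw
    | succ l ih =>
      intro w hw htw
      refine ih w hw (hU _ (by rw [map_smul, hw]) ?_)
      rwa [smul_smul, ← pow_succ']
  refine mem_spread.2 fun j => ?_
  cases j with
  | zero =>
    have h1 := key (n - 1)
    rw [Nat.sub_add_cancel (NeZero.one_le), h.x_pow, map_smul] at h1
    rw [pow_zero, Module.End.one_apply]
    exact hpow m _ (h.idem_apply_self _ _) h1
  | succ j => exact key j

/-- The power `x ^ l` brings the vertex `-j` to `0` only if `l = j + n q`, and then it is `t ^ (m q)
x ^ j`. So the single condition at `j` implies all the others. -/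
theorem idem_mem_spread_of_lt {U : Submodule R M} {j : ℕ} (hj : j < n) {v : M}
    (hv : e 0 ((x ^ j) v) ∈ U) : e (-j) v ∈ spread e x U := by
  refine mem_spread.2 fun l => ?_
  rw [h.idem_zero_x_pow, h.idem_apply]
  split_ifs with hl
  · have hmod : l % n = j := by
      rw [neg_inj, ZMod.natCast_eq_natCast_iff'] at hl
      rw [hl, Nat.mod_eq_of_lt hj]
    rw [← Nat.mod_add_div l n, hmod, add_comm j, pow_add, Module.End.mul_apply, h.x_pow_mul,
      Nat.cast_add, Nat.cast_mul, ZMod.natCast_self, zero_mul, zero_add, ← h.idem_zero_x_pow]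
    exact U.smul_mem _ hv
  · simp

theorem mem_spread_of_mem {U : Submodule R M} {v : M} (hv : v ∈ U) (hv' : e 0 v = v) :
    v ∈ spread e x U := by
  have := h.idem_mem_spread_of_lt (U := U) (j := 0) (v := v) (Nat.pos_of_neZero n)
    (by simpa [hv'] using hv)
  simpa [hv'] using this

theorem disjoint_spread (ht : ∀ v : M, t • v = 0 → v = 0) {U U' : Submodule R M}
    (hU : Disjoint U U') : Disjoint (spread e x U) (spread e x U') := by
  rw [Submodule.disjoint_def] at hU ⊢
  intro v hv hv'
  rw [← h.sum_idem_apply v]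
  refine Finset.sum_eq_zero fun i _ => ?_
  obtain ⟨j, _, rfl⟩ := exists_eq_neg_natCast i
  refine h.x_pow_injective ht j ?_
  rw [← h.idem_zero_x_pow]
  exact hU _ (mem_spread.1 hv j) (mem_spread.1 hv' j)

/-- A component at the vertex `-j` is decomposed at the vertex `0` and pulled back along the
injective `x ^ j`. Both pieces must therefore lie in the image of `x ^ j`, which is what `hU`
requires. -/
theorem codisjoint_spread (ht : ∀ v : M, t • v = 0 → v = 0) {U U' : Submodule R M}
    (hU : ∀ j < n, ∀ v, ∃ a b, e 0 ((x ^ j) v) = e 0 ((x ^ j) a) + e 0 ((x ^ j) b) ∧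
      e 0 ((x ^ j) a) ∈ U ∧ e 0 ((x ^ j) b) ∈ U') :
    Codisjoint (spread e x U) (spread e x U') := by
  rw [codisjoint_iff, eq_top_iff]
  intro v _
  rw [← h.sum_idem_apply v]
  refine sum_mem fun i _ => ?_
  obtain ⟨j, hj, rfl⟩ := exists_eq_neg_natCast i
  obtain ⟨a, b, hab, ha, hb⟩ := hU j hj v
  have : e (-j) v = e (-j) a + e (-j) b := by
    rw [← sub_eq_zero]
    refine h.x_pow_injective ht j ?_
    rw [map_sub, map_add, ← h.idem_zero_x_pow, ← h.idem_zero_x_pow, ← h.idem_zero_x_pow, hab,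
      sub_self]
  rw [this]
  exact Submodule.add_mem_sup (h.idem_mem_spread_of_lt hj ha) (h.idem_mem_spread_of_lt hj hb)

/-- A stable submodule on which division by `t` is possible is determined by its part at the
vertex `0`. -/
theorem le_of_idem_zero {N N' : Submodule R M} (hN : ∀ v, t • v ∈ N → v ∈ N)
    (hy : ∀ v ∈ N, y v ∈ N) (hx' : ∀ v ∈ N', x v ∈ N') (he' : ∀ i, ∀ v ∈ N', e i v ∈ N')
    (hle : ∀ v ∈ N', e 0 v = v → v ∈ N) : N' ≤ N := by
  intro v hv
  rw [← h.sum_idem_apply v]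
  refine sum_mem fun i _ => ?_
  obtain ⟨j, _, rfl⟩ := exists_eq_neg_natCast i
  have hxj : ∀ (j : ℕ) (w : M), w ∈ N' → (x ^ j) w ∈ N' := fun j w hw => by
    induction j with
    | zero => simpa using hw
    | succ j ih => rw [pow_succ']; exact hx' _ ih
  have hyj : ∀ (j : ℕ) (w : M), w ∈ N → (y ^ j) w ∈ N := fun j w hw => by
    induction j with
    | zero => simpa using hw
    | succ j ih => rw [pow_succ']; exact hy _ ih
  have htj : ∀ (j : ℕ) (w : M), t ^ j • w ∈ N → w ∈ N := fun j w hw => by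
    induction j with
    | zero => simpa using hw
    | succ j ih => exact ih (hN _ (by rwa [smul_smul, ← pow_succ']))
  -- Go to the vertex `0` by `x ^ j` and return by `y ^ j`: the round trip is multiplication by `t ^
  -- j`.
  refine htj j _ ?_
  rw [← h.y_pow_x_pow, ← h.idem_zero_x_pow]
  exact hyj j _ (hle _ (he' _ _ (hxj j _ hv)) (h.idem_apply_self _ _))

end IsCircularAction

/-! ### Bases of a module of rank two. -/

/-- `u` and `v` form a basis of the module. -/
def IsBasisPair (R : Type*) {F : Type*} [CommRing R] [AddCommGroup F] [Module R F] (u v : F) :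
    Prop :=
  (∀ f : F, ∃ α β : R, f = α • u + β • v) ∧ ∀ α β : R, α • u + β • v = 0 → α = 0 ∧ β = 0

namespace IsBasisPair

variable {R F : Type*} [CommRing R] [AddCommGroup F] [Module R F] {u v : F} {t : R}

theorem of_basis (b : Module.Basis (Fin 2) R F) : IsBasisPair R (b 0) (b 1) := by
  refine ⟨fun f => ⟨b.repr f 0, b.repr f 1, ?_⟩, fun α β h => ?_⟩
  · conv_lhs => rw [← b.sum_repr f, Fin.sum_univ_two]
  · have h1 := Fintype.linearIndependent_iff.1 b.linearIndependent ![α, β]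
      (by simpa [Fin.sum_univ_two] using h)
    exact ⟨by simpa using h1 0, by simpa using h1 1⟩

theorem swap (h : IsBasisPair R u v) : IsBasisPair R v u :=
  ⟨fun f => by obtain ⟨α, β, rfl⟩ := h.1 f; exact ⟨β, α, add_comm _ _⟩,
    fun α β h' => (h.2 β α (by rwa [add_comm])).symm⟩

theorem of_isUnit_det {p q : F} (h : IsBasisPair R p q) {a b c d : R}
    (hdet : IsUnit (a * d - b * c)) : IsBasisPair R (a • p + b • q) (c • p + d • q) := by
  obtain ⟨δ, hδ⟩ := hdet.exists_right_inv
  refine ⟨fun f => ?_, fun α β hαβ => ?_⟩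
  · obtain ⟨r, s, rfl⟩ := h.1 f
    -- Cramer's rule, with `δ` the inverse of the determinant.
    refine ⟨δ * (r * d - s * c), δ * (s * a - r * b), ?_⟩
    have h1 : r = r * ((a * d - b * c) * δ) := by rw [hδ, mul_one]
    have h2 : s = s * ((a * d - b * c) * δ) := by rw [hδ, mul_one]
    conv_lhs => rw [h1, h2]
    module
  · have := h.2 (α * a + β * c) (α * b + β * d) (by rw [← hαβ]; module)
    constructor
    · linear_combination (-α) * hδ + δ * d * this.1 - δ * c * this.2
    · linear_combination (-β) * hδ - δ * b * this.1 + δ * a * this.2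

theorem dvd_of_eq_smul (h : IsBasisPair R u v) {α β : R} {w : F}
    (hw : α • u + β • v = t • w) : t ∣ α ∧ t ∣ β := by
  obtain ⟨γ, δ, rfl⟩ := h.1 w
  have := h.2 (α - t * γ) (β - t * δ) (by
    rw [← sub_eq_zero] at hw
    rw [← hw]; module)
  exact ⟨⟨γ, sub_eq_zero.1 this.1⟩, ⟨δ, sub_eq_zero.1 this.2⟩⟩

/-- A vector outside `tF` has a unit coordinate, so it can replace the corresponding basis vector.
-/
theorem exists_of_not_smul (h : IsBasisPair R u v) (ht : ∀ a : R, IsUnit a ∨ t ∣ a) {f : F}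
    (hf : ∀ w, f ≠ t • w) : ∃ g, IsBasisPair R f g := by
  obtain ⟨a, b, rfl⟩ := h.1 f
  rcases ht a with ha | ⟨a, rfl⟩
  · exact ⟨(0 : R) • u + (1 : R) • v, h.of_isUnit_det (by simpa using ha)⟩
  rcases ht b with hb | ⟨b, rfl⟩
  · exact ⟨(1 : R) • u + (0 : R) • v, h.of_isUnit_det (by simpa using hb)⟩
  exact absurd (by module) (hf (a • u + b • v))

/-- The residues of `f` and `g` in `F/tF` are either independent or proportional. -/
theorem or_eq_smul_add_smul (h : IsBasisPair R u v) (ht : ∀ a : R, IsUnit a ∨ t ∣ a) {f g : F}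
    (hf : ∀ w, f ≠ t • w) (hg : ∀ w, g ≠ t • w) :
    IsBasisPair R f g ∨ ∃ (c : R) (w : F), IsUnit c ∧ g = c • f + t • w := by
  obtain ⟨f', hff'⟩ := h.exists_of_not_smul ht hf
  obtain ⟨c, d, rfl⟩ := hff'.1 g
  rcases ht d with hd | ⟨d, rfl⟩
  · left
    have := hff'.of_isUnit_det (a := 1) (b := 0) (c := c) (d := d) (by simpa using hd)
    simpa using this
  · rcases ht c with hc | ⟨c, rfl⟩
    · exact Or.inr ⟨c, d • f', hc, by module⟩
    · exact absurd (by module) (hg (c • f + d • f'))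

end IsBasisPair

/-! ### Splitting of chains between `t² F` and `F`. -/

section Chains

variable {R F : Type*} [CommRing R] [AddCommGroup F] [Module R F] {u v : F} {t : R}

theorem Submodule.mem_of_isUnit_smul_mem {L : Submodule R F} {a : R} (ha : IsUnit a)
    (h : a • v ∈ L) : v ∈ L := by
  obtain ⟨b, hb⟩ := ha.exists_left_inv
  simpa [smul_smul, hb] using L.smul_mem b h

/-- If `A` and `L` are comparable, `u ∈ A`, and the multiples of `v` in `A` lie in `L`, then `L`
contains the components along `u` of its elements. -/
theorem smul_mem_of_le_or_le {A L : Submodule R F} (hAL : A ≤ L ∨ L ≤ A) (hu : u ∈ A) {α β : R}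
    (hβ : β • v ∈ A → β • v ∈ L) (h : α • u + β • v ∈ L) : α • u ∈ L := by
  rcases hAL with hAL | hAL
  · exact L.smul_mem _ (hAL hu)
  · exact (L.add_mem_iff_left (hβ ((A.add_mem_iff_right (A.smul_mem α hu)).1 (hAL h)))).1 h

/-- Every chain of submodules between `t² F` and a free module `F` of rank two over a discrete
valuation ring with uniformizer `t` splits along some basis of `F`. -/
theorem exists_isBasisPair_of_chain {p q : F} (hpq : IsBasisPair R p q)
    (ht : ∀ a : R, IsUnit a ∨ t ∣ a) {S : Set (Submodule R F)}
    (hS : ∀ L ∈ S, ∀ L' ∈ S, L ≤ L' ∨ L' ≤ L) (hSt : ∀ L ∈ S, ∀ f, t • t • f ∈ L) :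
    ∃ u v, IsBasisPair R u v ∧ ∀ L ∈ S, ∀ α β : R, α • u + β • v ∈ L → α • u ∈ L := by
  -- If some `A` has an element `u` outside `tF` but does not contain `tF`, then the multiples of
  -- `v` in `A` lie in `t² F`, hence in every `L`, and this `u` splits the whole chain.
  by_cases h1 : ∃ A ∈ S, (∃ u ∈ A, ∀ w, u ≠ t • w) ∧ ∃ f, t • f ∉ A
  · obtain ⟨A, hA, ⟨u, hu, hu'⟩, f, hf⟩ := h1
    obtain ⟨v, huv⟩ := hpq.exists_of_not_smul ht hu'
    refine ⟨u, v, huv, fun L hL α β => smul_mem_of_le_or_le (hS A hA L hL) hu fun hβ => ?_⟩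
    have hv : t • v ∉ A := fun hv => hf (by
      obtain ⟨a, b, rfl⟩ := huv.1 f
      rw [smul_add, smul_comm t a, smul_comm t b]
      exact A.add_mem (A.smul_mem _ (A.smul_mem _ hu)) (A.smul_mem _ hv))
    rcases ht β with hb | ⟨β, rfl⟩
    · exact absurd (A.smul_mem t (A.mem_of_isUnit_smul_mem hb hβ)) hv
    rcases ht β with hb | ⟨β, rfl⟩
    · exact absurd (A.mem_of_isUnit_smul_mem hb (by rwa [smul_smul, mul_comm])) hv
    · rw [mul_smul, mul_smul]; exact hSt L hL _
  have h2 : ∀ L ∈ S, (∀ u ∈ L, ∃ w, u = t • w) ∨ ∀ f, t • f ∈ L := by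
    intro L hL
    by_contra! h
    exact h1 ⟨L, hL, h⟩
  clear h1
  -- The members above `tF` give at most one line in the plane `F/tF`. Those inside `tF` give at
  -- most one line in `tF/t²F`, which division by `t` carries to `F/tF`. A vector is good for one
  -- kind if it splits those members with any complementary `v`.
  let goodTop (u : F) : Prop := ∀ v, IsBasisPair R u v → ∀ L ∈ S, (∀ f, t • f ∈ L) →
    ∀ α β : R, α • u + β • v ∈ L → α • u ∈ L
  let goodBot (u : F) : Prop := ∀ v, IsBasisPair R u v → ∀ L ∈ S, (∀ u ∈ L, ∃ w, u = t • w) →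
    ∀ α β : R, α • u + β • v ∈ L → α • u ∈ L
  have top_of_mem : ∀ A ∈ S, A ≠ ⊤ → ∀ u ∈ A, goodTop u := by
    intro A hA hAt u hu v huv L hL hLt α β
    refine smul_mem_of_le_or_le (hS A hA L hL) hu fun hβ => ?_
    rcases ht β with hb | ⟨β, rfl⟩
    · refine absurd (eq_top_iff.2 fun f _ => ?_) hAt
      obtain ⟨a, b, rfl⟩ := huv.1 f
      exact A.add_mem (A.smul_mem _ hu) (A.smul_mem _ (A.mem_of_isUnit_smul_mem hb hβ))
    · rw [mul_smul]; exact hLt _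
  -- Without a line, the members above `tF` are `F` or `tF`, and any basis splits them.
  have top_of_not : (¬∃ A ∈ S, A ≠ ⊤ ∧ ∃ u ∈ A, ∀ w, u ≠ t • w) → ∀ u, goodTop u := by
    intro hno u v huv L hL hLt α β h
    by_cases hL' : L = ⊤
    · rw [hL']; trivial
    push Not at hno
    obtain ⟨w, hw⟩ := hno L hL hL' _ h
    obtain ⟨⟨α, rfl⟩, -⟩ := huv.dvd_of_eq_smul hw
    rw [mul_smul]; exact hLt _
  have bot_of_mem : ∀ C ∈ S, (∃ f, t • f ∉ C) → ∀ u, t • u ∈ C → goodBot u := by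
    rintro C hC ⟨f, hf⟩ u hu v huv L hL hLt α β h
    obtain ⟨w, hw⟩ := hLt _ h
    obtain ⟨⟨α, rfl⟩, ⟨β, rfl⟩⟩ := huv.dvd_of_eq_smul hw
    rw [mul_comm, mul_comm t, mul_smul, mul_smul] at h
    rw [mul_comm, mul_smul]
    refine smul_mem_of_le_or_le (hS C hC L hL) hu (fun hβ => ?_) h
    rcases ht β with hb | ⟨β, rfl⟩
    · refine absurd ?_ hf
      obtain ⟨a, b, rfl⟩ := huv.1 f
      rw [smul_add, smul_comm t a, smul_comm t b]
      exact C.add_mem (C.smul_mem _ hu) (C.smul_mem _ (C.mem_of_isUnit_smul_mem hb hβ))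
    · rw [mul_smul, smul_comm β]; exact hSt L hL _
  have bot_of_not : (¬∃ C ∈ S, (∃ f, t • f ∉ C) ∧ ∃ u, t • u ∈ C ∧ ∀ w, u ≠ t • w) →
      ∀ u, goodBot u := by
    intro hno u v huv L hL hLt α β h
    obtain ⟨w, hw⟩ := hLt _ h
    obtain ⟨⟨α, rfl⟩, ⟨β, rfl⟩⟩ := huv.dvd_of_eq_smul hw
    by_cases hL' : ∀ f, t • f ∈ L
    · rw [mul_smul]; exact hL' _
    push Not at hno hL'
    obtain ⟨w, hw⟩ := hno L hL hL' (α • u + β • v) (by simpa [smul_add, smul_smul] using h)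
    obtain ⟨⟨α, rfl⟩, -⟩ := huv.dvd_of_eq_smul hw
    rw [mul_smul, mul_smul]; exact hSt L hL _
  have finish : ∀ u v, IsBasisPair R u v → goodTop u → goodBot u → ∃ u v, IsBasisPair R u v ∧
      ∀ L ∈ S, ∀ α β : R, α • u + β • v ∈ L → α • u ∈ L := fun u v huv htop hbot =>
    ⟨u, v, huv, fun L hL => (h2 L hL).elim (hbot v huv L hL) (htop v huv L hL)⟩
  by_cases hA : ∃ A ∈ S, A ≠ ⊤ ∧ ∃ u ∈ A, ∀ w, u ≠ t • w
  · obtain ⟨A, hA, hAt, u, hu, hu'⟩ := hA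
    obtain ⟨v, huv⟩ := hpq.exists_of_not_smul ht hu'
    by_cases hC : ∃ C ∈ S, (∃ f, t • f ∉ C) ∧ ∃ u, t • u ∈ C ∧ ∀ w, u ≠ t • w
    · obtain ⟨C, hC, hCt, v', hv, hv'⟩ := hC
      -- Two distinct lines are spanned by the two basis vectors; if the lines coincide, `u` serves
      -- for both, since `t² F ≤ C` gives `t • u ∈ C`.
      rcases hpq.or_eq_smul_add_smul ht hu' hv' with huv' | ⟨c, w, hc, rfl⟩
      · refine ⟨u, v', huv', fun L hL α β h => ?_⟩
        rcases h2 L hL with hL' | hL'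
        · refine (L.add_mem_iff_left ?_).1 h
          exact bot_of_mem C hC hCt v' hv u huv'.swap L hL hL' β α (by rwa [add_comm])
        · exact top_of_mem A hA hAt u hu v' huv' L hL hL' α β h
      · refine finish u v huv (top_of_mem A hA hAt u hu) (bot_of_mem C hC hCt u ?_)
        rw [smul_add, C.add_mem_iff_left (hSt C hC w), smul_comm] at hv
        exact C.mem_of_isUnit_smul_mem hc hv
    · exact finish u v huv (top_of_mem A hA hAt u hu) (bot_of_not hC u)
  · by_cases hC : ∃ C ∈ S, (∃ f, t • f ∉ C) ∧ ∃ u, t • u ∈ C ∧ ∀ w, u ≠ t • w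
    · obtain ⟨C, hC, hCt, u, hu, hu'⟩ := hC
      obtain ⟨v, huv⟩ := hpq.exists_of_not_smul ht hu'
      exact finish u v huv (top_of_not hA u) (bot_of_mem C hC hCt u hu)
    · exact finish p q hpq (top_of_not hA p) (bot_of_not hC p)

end Chains

/-! ### Splitting of a circular action. -/

namespace IsCircularAction

variable {n : ℕ} [NeZero n] {R M : Type*} [CommRing R] [AddCommGroup M] [Module R M] {t : R}
  {m : ℕ} {e : ZMod n → Module.End R M} {x y : Module.End R M}

/-- A submodule that is stable under all the operators. -/
structure IsStable (e : ZMod n → Module.End R M) (x y : Module.End R M) (N : Submodule R M) :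
    Prop where
  idem_mem : ∀ i, ∀ v ∈ N, e i v ∈ N
  x_mem : ∀ v ∈ N, x v ∈ N
  y_mem : ∀ v ∈ N, y v ∈ N

theorem baseChange (K : Type*) [CommRing K] [Algebra R K] (h : IsCircularAction t m e x y) :
    IsCircularAction (algebraMap R K t) m (fun i => (e i).baseChange K) (x.baseChange K)
      (y.baseChange K) := by
  have hsmul : ∀ (f : Module.End R M) (r : R), (∀ v, f v = r • v) →
      ∀ v : K ⊗[R] M, f.baseChange K v = algebraMap R K r • v := by
    intro f r hf v
    have : f = r • LinearMap.id := LinearMap.ext hf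
    rw [this, LinearMap.baseChange_smul, LinearMap.baseChange_id, algebraMap_smul]
    rfl
  exact
  { idem_mul_idem := fun i j => by
      have := congrArg (LinearMap.baseChange K) (h.idem_mul_idem i j)
      rw [LinearMap.baseChange_mul] at this
      rw [this]
      split_ifs <;> simp
    sum_idem := by
      have := congrArg (Module.End.baseChangeHom R K M) h.sum_idem
      rw [map_sum, map_one] at this
      exact this
    x_mul_idem := fun i => by
      rw [← LinearMap.baseChange_mul, h.x_mul_idem, LinearMap.baseChange_mul]
    y_mul_idem := fun i => by
      rw [← LinearMap.baseChange_mul, h.y_mul_idem, LinearMap.baseChange_mul]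
    x_mul_y := fun v => by
      rw [← Module.End.mul_apply, ← LinearMap.baseChange_mul]
      exact hsmul _ _ h.x_mul_y v
    y_mul_x := fun v => by
      rw [← Module.End.mul_apply, ← LinearMap.baseChange_mul]
      exact hsmul _ _ h.y_mul_x v
    x_pow := fun v => by
      rw [← LinearMap.baseChange_pow, ← map_pow]
      exact hsmul _ _ h.x_pow v }

theorem isStable_spread (h : IsCircularAction t m e x y) {U : Submodule R M}
    (hU : ∀ v, e 0 v = v → t • v ∈ U → v ∈ U) : IsStable e x y (spread e x U) :=
  ⟨fun i _ hv => h.idem_mem_spread hv i, fun _ => x_mem_spread, fun _ => h.y_mem_spread hU⟩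

/-- The line `Ru` is saturated at the vertex `0`, because `u` belongs to a basis and there is no
`t`-torsion. -/
theorem isStable_spread_span (h : IsCircularAction t m e x y)
    (ht0 : ∀ v : M, t • v = 0 → v = 0) {u v : LinearMap.range (e 0)} (huv : IsBasisPair R u v) :
    IsStable e x y (spread e x (R ∙ (u : M))) := by
  refine h.isStable_spread fun w hw htw => ?_
  obtain ⟨α, β, hαβ⟩ := huv.1 ⟨w, ⟨w, hw⟩⟩
  obtain ⟨γ, hγ⟩ := Submodule.mem_span_singleton.1 htw
  obtain rfl : w = α • (u : M) + β • (v : M) := congrArg Subtype.val hαβ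
  have h1 := huv.2 (t * α - γ) (t * β) (Subtype.ext (by
    have : (t * α - γ) • (u : M) + (t * β) • (v : M) =
        t • (α • (u : M) + β • (v : M)) - γ • (u : M) := by
      module
    simpa [hγ] using this))
  have h2 : β • (v : M) = 0 := ht0 _ (by rw [smul_smul, h1.2, zero_smul])
  rw [h2, add_zero]
  exact Submodule.smul_mem _ _ (Submodule.mem_span_singleton_self _)

theorem spread_span_ne_bot [Nontrivial R] (h : IsCircularAction t m e x y)
    {u v : LinearMap.range (e 0)} (huv : IsBasisPair R u v) : spread e x (R ∙ (u : M)) ≠ ⊥ := by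
  intro hbot
  have hu : e 0 (u : M) = u := by
    obtain ⟨w, hw⟩ := u.2
    rw [← hw, h.idem_apply_self]
  have h0 := h.mem_spread_of_mem (Submodule.mem_span_singleton_self (R := R) (u : M)) hu
  rw [hbot, Submodule.mem_bot] at h0
  have hu0 : u = 0 := Subtype.ext h0
  exact one_ne_zero (huv.2 1 0 (by simp [hu0])).1

/-- If `x ^ n` is at most `t²` and the module at the vertex `0` is free of rank two, then the
module splits. -/
theorem exists_isCompl [Nontrivial R] (h : IsCircularAction t m e x y) (hm : m ≤ 2)
    (ht0 : ∀ v : M, t • v = 0 → v = 0) (ht : ∀ a : R, IsUnit a ∨ t ∣ a)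
    {p q : LinearMap.range (e 0)} (hpq : IsBasisPair R p q) :
    ∃ N P : Submodule R M, IsCompl N P ∧ N ≠ ⊥ ∧ P ≠ ⊥ ∧ IsStable e x y N ∧ IsStable e x y P := by
  let L (j : ℕ) : Submodule R (LinearMap.range (e 0)) :=
    (LinearMap.range (e 0 * x ^ j)).comap (LinearMap.range (e 0)).subtype
  have hL : ∀ j v, v ∈ L j ↔ ∃ w, e 0 ((x ^ j) w) = v := fun j v => Iff.rfl
  have hanti : ∀ i j, i ≤ j → L j ≤ L i := by
    intro i j hij v hv
    obtain ⟨w, hw⟩ := (hL _ _).1 hv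
    refine (hL _ _).2 ⟨(x ^ (j - i)) w, ?_⟩
    rw [← Module.End.mul_apply (x ^ i), ← pow_add, Nat.add_sub_cancel' hij, hw]
  obtain ⟨u, v, huv, hdec⟩ := exists_isBasisPair_of_chain hpq ht (S := {K | ∃ j < n, K = L j})
    (by
      rintro _ ⟨i, _, rfl⟩ _ ⟨j, _, rfl⟩
      exact (le_total j i).imp (hanti _ _) (hanti _ _))
    (by
      rintro _ ⟨j, hj, rfl⟩ ⟨_, w, rfl⟩
      -- Applying `x ^ j` to this witness gives `t ^ (2 - m) x ^ n w = t² w`; this is where `m ≤ 2`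
      -- is needed.
      refine (hL _ _).2 ⟨t ^ (2 - m) • (x ^ (n - j)) w, ?_⟩
      rw [map_smul, ← Module.End.mul_apply (x ^ j), ← pow_add, Nat.add_sub_cancel' hj.le, h.x_pow,
        smul_smul, ← pow_add, Nat.sub_add_cancel hm, map_smul, pow_two, mul_smul]
      rfl)
  have hdisj : Disjoint (R ∙ (u : M)) (R ∙ (v : M)) := by
    rw [Submodule.disjoint_def]
    intro w hw hw'
    obtain ⟨α, rfl⟩ := Submodule.mem_span_singleton.1 hw
    obtain ⟨β, hβ⟩ := Submodule.mem_span_singleton.1 hw'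
    rw [(huv.2 α (-β) (Subtype.ext (by simp [hβ]))).1, zero_smul]
  refine ⟨spread e x (R ∙ (u : M)), spread e x (R ∙ (v : M)),
    ⟨h.disjoint_spread ht0 hdisj, h.codisjoint_spread ht0 fun j hj w => ?_⟩,
    h.spread_span_ne_bot huv, h.spread_span_ne_bot huv.swap, h.isStable_spread_span ht0 huv,
    h.isStable_spread_span ht0 huv.swap⟩
  obtain ⟨α, β, hαβ⟩ := huv.1 ⟨e 0 ((x ^ j) w), ⟨_, rfl⟩⟩
  have hmem : α • u + β • v ∈ L j := by
    rw [← hαβ]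
    exact ⟨w, rfl⟩
  have hα := hdec _ ⟨j, hj, rfl⟩ α β hmem
  have hβ := ((L j).add_mem_iff_right hα).1 hmem
  obtain ⟨a, ha⟩ := (hL _ _).1 hα
  obtain ⟨b, hb⟩ := (hL _ _).1 hβ
  refine ⟨a, b, ?_, ?_, ?_⟩
  · rw [ha, hb]
    exact congrArg Subtype.val hαβ
  · rw [ha]
    exact Submodule.smul_mem _ _ (Submodule.mem_span_singleton_self _)
  · rw [hb]
    exact Submodule.smul_mem _ _ (Submodule.mem_span_singleton_self _)

end IsCircularAction

/-! ### Stable submodules of `B_{k,n}`-modules, integrally and generically. -/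

namespace BoundaryAlgebra

variable {k n : ℕ} [NeZero n] {M : Type u} [AddCommGroup M] [Module (BoundaryAlgebra k n) M]
  [Module ℂ⟦X⟧ M] [IsScalarTower ℂ⟦X⟧ (BoundaryAlgebra k n) M]

variable (M) in
/-- The action of an element of `B_{k,n}` on a module, as a `ℂ[[t]]`-linear map. -/
noncomputable abbrev act (b : BoundaryAlgebra k n) : Module.End ℂ⟦X⟧ M :=
  Algebra.lsmul ℂ⟦X⟧ ℂ⟦X⟧ M b

variable (M) in
theorem isCircularAction_act (hkn : k ≤ n) :
    IsCircularAction (PowerSeries.X : ℂ⟦X⟧) (n - k) (fun i => act M (proj k n (idem n i)))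
      (act M (proj k n (xSum n))) (act M (proj k n (ySum n))) where
  idem_mul_idem i j := by
    rw [← map_mul, ← map_mul, BoundaryAlgebra.idem_mul_idem]
    split_ifs <;> simp
  sum_idem := by rw [← map_sum, ← map_sum, BoundaryAlgebra.sum_idem, map_one, map_one]
  x_mul_idem i := by rw [← map_mul, ← map_mul, xSum_mul_idem, map_mul, map_mul]
  y_mul_idem i := by rw [← map_mul, ← map_mul, ySum_mul_idem, map_mul, map_mul]
  x_mul_y v := by
    rw [← Module.End.mul_apply, ← map_mul, proj_xSum_mul_proj_ySum]
    exact algebraMap_smul _ _ _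
  y_mul_x v := by
    rw [← Module.End.mul_apply, ← map_mul, proj_ySum_mul_proj_xSum]
    exact algebraMap_smul _ _ _
  x_pow v := by
    rw [← map_pow, proj_xSum_pow_card hkn, ← map_pow]
    exact algebraMap_smul _ _ _

open IsCircularAction

theorem smul_mem_of_isStable (hk : 0 < k) (hkn : k < n) [Module.Finite ℂ⟦X⟧ M]
    {N : Submodule ℂ⟦X⟧ M}
    (hN : IsStable (fun i => act M (proj k n (idem n i))) (act M (proj k n (xSum n)))
      (act M (proj k n (ySum n))) N) (b : BoundaryAlgebra k n) {m : M} (hm : m ∈ N) : b • m ∈ N :=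
  smul_mem_of_stable hk hkn hN.idem_mem hN.x_mem hN.y_mem b hm

/-- The `t`-adic argument is meaningless over `K`, where `t` is invertible. It is applied to the
preimage `N₀` of `N` in `M`, and denominators are cleared. -/
theorem baseChange_act_mem_of_isStable (hk : 0 < k) (hkn : k < n) [Module.Finite ℂ⟦X⟧ M]
    {N : Submodule FracField (FracField ⊗[ℂ⟦X⟧] M)}
    (hN : IsStable (fun i => (act M (proj k n (idem n i))).baseChange FracField)
      ((act M (proj k n (xSum n))).baseChange FracField)
      ((act M (proj k n (ySum n))).baseChange FracField) N)
    (b : BoundaryAlgebra k n) {v : FracField ⊗[ℂ⟦X⟧] M} (hv : v ∈ N) :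
    (act M b).baseChange FracField v ∈ N := by
  let N₀ : Submodule ℂ⟦X⟧ M :=
    (N.restrictScalars ℂ⟦X⟧).comap (TensorProduct.mk ℂ⟦X⟧ FracField M 1)
  have hN₀ : IsStable (fun i => act M (proj k n (idem n i))) (act M (proj k n (xSum n)))
      (act M (proj k n (ySum n))) N₀ :=
    ⟨fun i m hm => hN.idem_mem i _ hm, fun m hm => hN.x_mem _ hm, fun m hm => hN.y_mem _ hm⟩
  have : IsLocalizedModule (nonZeroDivisors ℂ⟦X⟧) (TensorProduct.mk ℂ⟦X⟧ FracField M 1) :=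
    (isLocalizedModule_iff_isBaseChange (nonZeroDivisors ℂ⟦X⟧) FracField _).2
      (TensorProduct.isBaseChange ℂ⟦X⟧ M FracField)
  obtain ⟨⟨m, s⟩, hs⟩ :=
    IsLocalizedModule.surj (nonZeroDivisors ℂ⟦X⟧) (TensorProduct.mk ℂ⟦X⟧ FracField M 1) v
  have hs0 : algebraMap ℂ⟦X⟧ FracField s ≠ 0 :=
    IsFractionRing.to_map_ne_zero_of_mem_nonZeroDivisors s.2
  replace hs : algebraMap ℂ⟦X⟧ FracField s • v = 1 ⊗ₜ[ℂ⟦X⟧] m := by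
    rw [algebraMap_smul]; exact hs
  have hm : m ∈ N₀ := by
    change 1 ⊗ₜ[ℂ⟦X⟧] m ∈ N
    rw [← hs]; exact N.smul_mem _ hv
  have hbm : 1 ⊗ₜ[ℂ⟦X⟧] (b • m) ∈ N := smul_mem_of_isStable hk hkn hN₀ b hm
  rw [← inv_smul_smul₀ hs0 ((act M b).baseChange FracField v), ← map_smul, hs]
  exact N.smul_mem _ hbm

-- The rank as the rank at the vertex `0`.

attribute [local instance] genericModule

theorem tmul_smul_eq (c : FracField) (b : BoundaryAlgebra k n) (v : FracField ⊗[ℂ⟦X⟧] M) :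
    (c ⊗ₜ[ℂ⟦X⟧] b : FracField ⊗[ℂ⟦X⟧] BoundaryAlgebra k n) • v =
      c • (act M b).baseChange FracField v := by
  induction v using TensorProduct.induction_on with
  | zero => simp
  | tmul d m => exact genericAction_tmul k n M c d b m
  | add v w hv hw => rw [smul_add, hv, hw, map_add, smul_add]

/-- A submodule of the generic module, as a vector space over `K`. -/
noncomputable def genericRestrict
    (N : Submodule (FracField ⊗[ℂ⟦X⟧] BoundaryAlgebra k n) (FracField ⊗[ℂ⟦X⟧] M)) :
    Submodule FracField (FracField ⊗[ℂ⟦X⟧] M) :=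
  { N.toAddSubmonoid with
    smul_mem' := fun c v hv => by
      have := N.smul_mem (c ⊗ₜ[ℂ⟦X⟧] 1) hv
      have h1 : act M (1 : BoundaryAlgebra k n) = LinearMap.id := map_one _
      rwa [tmul_smul_eq, h1, LinearMap.baseChange_id] at this }

theorem baseChange_act_mem_genericRestrict
    (N : Submodule (FracField ⊗[ℂ⟦X⟧] BoundaryAlgebra k n) (FracField ⊗[ℂ⟦X⟧] M))
    (b : BoundaryAlgebra k n) {v : FracField ⊗[ℂ⟦X⟧] M} (hv : v ∈ genericRestrict N) :
    (act M b).baseChange FracField v ∈ genericRestrict N := by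
  have := N.smul_mem (1 ⊗ₜ[ℂ⟦X⟧] b) hv
  rwa [tmul_smul_eq, one_smul] at this

/-- A stable subspace of the generic module, as a submodule. -/
noncomputable def genericOfStable (hk : 0 < k) (hkn : k < n) [Module.Finite ℂ⟦X⟧ M]
    (N : Submodule FracField (FracField ⊗[ℂ⟦X⟧] M))
    (hN : IsStable (fun i => (act M (proj k n (idem n i))).baseChange FracField)
      ((act M (proj k n (xSum n))).baseChange FracField)
      ((act M (proj k n (ySum n))).baseChange FracField) N) :
    Submodule (FracField ⊗[ℂ⟦X⟧] BoundaryAlgebra k n) (FracField ⊗[ℂ⟦X⟧] M) :=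
  { N.toAddSubmonoid with
    smul_mem' := fun a v hv => by
      change a • v ∈ N
      induction a using TensorProduct.induction_on with
      | zero =>
        have h0 : (0 : FracField ⊗[ℂ⟦X⟧] BoundaryAlgebra k n) • v = 0 := Module.zero_smul v
        exact (congrArg (· ∈ N) h0).mpr N.zero_mem
      | tmul c b =>
        rw [tmul_smul_eq]
        exact N.smul_mem _ (baseChange_act_mem_of_isStable hk hkn hN b hv)
      | add a a' ha ha' => rw [add_smul]; exact N.add_mem ha ha' }

theorem mem_genericOfStable (hk : 0 < k) (hkn : k < n) [Module.Finite ℂ⟦X⟧ M]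
    {N : Submodule FracField (FracField ⊗[ℂ⟦X⟧] M)}
    (hN : IsStable (fun i => (act M (proj k n (idem n i))).baseChange FracField)
      ((act M (proj k n (xSum n))).baseChange FracField)
      ((act M (proj k n (ySum n))).baseChange FracField) N) {v : FracField ⊗[ℂ⟦X⟧] M} :
    v ∈ genericOfStable hk hkn N hN ↔ v ∈ N := Iff.rfl

variable (k n M) in
/-- The `ℂ[[t]]`-module at the vertex `0`. -/
noncomputable abbrev vertexModule : Submodule ℂ⟦X⟧ M :=
  LinearMap.range (act M (proj k n (idem n 0)))

variable (k n M) in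
/-- The inclusion of the generic module at the vertex `0`. -/
noncomputable abbrev vertexIncl :
    FracField ⊗[ℂ⟦X⟧] vertexModule k n M →ₗ[FracField] FracField ⊗[ℂ⟦X⟧] M :=
  (vertexModule k n M).subtype.baseChange FracField

variable (k n M) in
/-- The projection onto the generic module at the vertex `0`. -/
noncomputable abbrev vertexProj :
    FracField ⊗[ℂ⟦X⟧] M →ₗ[FracField] FracField ⊗[ℂ⟦X⟧] vertexModule k n M :=
  (act M (proj k n (idem n 0))).rangeRestrict.baseChange FracField

theorem vertexIncl_vertexProj (v : FracField ⊗[ℂ⟦X⟧] M) :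
    vertexIncl k n M (vertexProj k n M v) =
      (act M (proj k n (idem n 0))).baseChange FracField v := by
  rw [← LinearMap.comp_apply, ← LinearMap.baseChange_comp]
  rfl

theorem vertexProj_vertexIncl (hkn : k ≤ n) (v : FracField ⊗[ℂ⟦X⟧] vertexModule k n M) :
    vertexProj k n M (vertexIncl k n M v) = v := by
  rw [← LinearMap.comp_apply, ← LinearMap.baseChange_comp]
  have : (act M (proj k n (idem n 0))).rangeRestrict ∘ₗ (vertexModule k n M).subtype =
      LinearMap.id := by
    ext ⟨_, w, rfl⟩
    exact (isCircularAction_act M hkn).idem_apply_self 0 w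
  rw [this, LinearMap.baseChange_id]
  rfl

theorem vertexIncl_injective (hkn : k ≤ n) : Function.Injective (vertexIncl k n M) :=
  Function.LeftInverse.injective (vertexProj_vertexIncl hkn)

theorem mem_of_algebraMap_X_smul_mem {V : Type*} [AddCommGroup V] [Module FracField V]
    (N : Submodule FracField V) {v : V}
    (hv : algebraMap ℂ⟦X⟧ FracField PowerSeries.X • v ∈ N) : v ∈ N :=
  (N.smul_mem_iff (by
    rw [Ne, IsFractionRing.to_map_eq_zero_iff]
    exact PowerSeries.X_ne_zero)).1 hv

/-- Restriction to the vertex `0` is strictly monotone: `t` is invertible over `K`, so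
`le_of_idem_zero` applies. -/
theorem krullDim_submodule_generic_le (hkn : k ≤ n) :
    Order.krullDim (Submodule (FracField ⊗[ℂ⟦X⟧] BoundaryAlgebra k n) (FracField ⊗[ℂ⟦X⟧] M)) ≤
      Order.krullDim (Submodule FracField (FracField ⊗[ℂ⟦X⟧] vertexModule k n M)) := by
  refine Order.krullDim_le_of_strictMono
    (fun N => (genericRestrict N).comap (vertexIncl k n M)) fun N N' hlt => ?_
  refine lt_of_le_not_ge (fun v hv => hlt.le hv) fun hle => hlt.not_ge ?_
  refine ((isCircularAction_act M hkn).baseChange FracField).le_of_idem_zero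
    (N := genericRestrict N) (N' := genericRestrict N')
    (fun _ => mem_of_algebraMap_X_smul_mem _)
    (fun _ => baseChange_act_mem_genericRestrict N _)
    (fun _ => baseChange_act_mem_genericRestrict N' _)
    (fun _ _ => baseChange_act_mem_genericRestrict N' _) fun v hv hv0 => ?_
  rw [← hv0, ← vertexIncl_vertexProj] at hv ⊢
  exact hle hv

/-- Spreading is strictly monotone, since a subspace at the vertex `0` is recovered as the part of
its spread there. Saturation is automatic over `K`. -/
theorem le_krullDim_submodule_generic (hk : 0 < k) (hkn : k < n) [Module.Finite ℂ⟦X⟧ M] :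
    Order.krullDim (Submodule FracField (FracField ⊗[ℂ⟦X⟧] vertexModule k n M)) ≤
      Order.krullDim
        (Submodule (FracField ⊗[ℂ⟦X⟧] BoundaryAlgebra k n) (FracField ⊗[ℂ⟦X⟧] M)) := by
  have h := (isCircularAction_act M hkn.le).baseChange FracField
  refine Order.krullDim_le_of_strictMono
    (fun U => genericOfStable hk hkn (spread _ _ (U.map (vertexIncl k n M)))
      (h.isStable_spread fun _ _ => mem_of_algebraMap_X_smul_mem _)) fun U U' hlt => ?_
  refine lt_of_le_not_ge (fun v hv => ?_) fun hle => hlt.not_ge fun w hw => ?_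
  · rw [mem_genericOfStable] at hv ⊢
    exact spread_mono (Submodule.map_mono hlt.le) hv
  · have hw0 : (act M (proj k n (idem n 0))).baseChange FracField (vertexIncl k n M w) =
        vertexIncl k n M w := by
      rw [← vertexIncl_vertexProj, vertexProj_vertexIncl hkn.le]
    have h1 := h.mem_spread_of_mem (Submodule.mem_map_of_mem hw) hw0
    have h2 := hle ((mem_genericOfStable hk hkn _).2 h1)
    rw [mem_genericOfStable] at h2
    have h3 := mem_spread.1 h2 0
    rw [pow_zero, Module.End.one_apply, hw0] at h3
    obtain ⟨w', hw', heq⟩ := h3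
    rwa [← vertexIncl_injective hkn.le heq]

theorem rank_eq_finrank_vertexModule (hk : 0 < k) (hkn : k < n)
    (hCM : IsCohenMacaulay k n M) :
    rank k n M = Module.finrank ℂ⟦X⟧ (vertexModule k n M) := by
  have := hCM.1
  have := hCM.2
  rw [← Module.finrank_baseChange (R := FracField), ← Module.length_eq_finrank]
  refine WithBot.coe_injective ?_
  rw [rank, Module.coe_length, Module.coe_length]
  exact le_antisymm (krullDim_submodule_generic_le hkn.le) (le_krullDim_submodule_generic hk hkn)

/-! ### Decomposition of modules of rank two. -/

theorem exists_isCompl_isStable (hk : 0 < k) (hkn : k < n) (hn : n < 6)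
    (hCM : IsCohenMacaulay k n M) (hrank : rank k n M = 2) :
    ∃ N P : Submodule ℂ⟦X⟧ M, IsCompl N P ∧ N ≠ ⊥ ∧ P ≠ ⊥ ∧
      IsStable (fun i => act M (proj k n (idem n i))) (act M (proj k n (xSum n)))
        (act M (proj k n (ySum n))) N ∧
      IsStable (fun i => act M (proj k n (idem n i))) (act M (proj k n (xSum n)))
        (act M (proj k n (ySum n))) P := by
  have := hCM.1
  have := hCM.2
  have hfin : Module.finrank ℂ⟦X⟧ (vertexModule k n M) = 2 := by
    have := rank_eq_finrank_vertexModule hk hkn hCM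
    rw [hrank] at this
    exact_mod_cast this.symm
  have hpq := IsBasisPair.of_basis (Module.finBasisOfFinrankEq ℂ⟦X⟧ _ hfin)
  have h := isCircularAction_act M hkn.le
  have ht0 : ∀ v : M, (PowerSeries.X : ℂ⟦X⟧) • v = 0 → v = 0 := fun v hv =>
    (smul_eq_zero.1 hv).resolve_left PowerSeries.X_ne_zero
  have ht : ∀ a : ℂ⟦X⟧, IsUnit a ∨ PowerSeries.X ∣ a := fun a => by
    rw [PowerSeries.isUnit_iff_constantCoeff, PowerSeries.X_dvd_iff, isUnit_iff_ne_zero]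
    exact (em _).symm
  -- If `n - k ≥ 3`, then `n < 6` gives `k ≤ 2`, and the roles of `x` and `y` are exchanged.
  by_cases hm : n - k ≤ 2
  · exact h.exists_isCompl hm ht0 ht hpq
  · have h' := h.swap (m' := k) fun v => by
      rw [← map_pow, proj_ySum_pow_card hkn.le, ← map_pow]
      exact algebraMap_smul _ _ _
    -- The exchanged action has the idempotent of `-0` at its base vertex, so the basis is
    -- transported to that range.
    have h0 : act M (proj k n (idem n 0)) = act M (proj k n (idem n (-0))) := by rw [neg_zero]
    unfold vertexModule at hpq
    generalize Module.finBasisOfFinrankEq ℂ⟦X⟧ _ hfin = b at hpq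
    clear hpq
    unfold vertexModule at b
    rw [h0] at b
    obtain ⟨N, P, hNP, hN, hP, hsN, hsP⟩ :=
      h'.exists_isCompl (by omega) ht0 ht (IsBasisPair.of_basis b)
    have key : ∀ {Q : Submodule ℂ⟦X⟧ M}, IsStable (fun i => act M (proj k n (idem n (-i))))
        (act M (proj k n (ySum n))) (act M (proj k n (xSum n))) Q →
        IsStable (fun i => act M (proj k n (idem n i))) (act M (proj k n (xSum n)))
          (act M (proj k n (ySum n))) Q := fun hQ =>
      ⟨fun i v hv => by simpa using hQ.idem_mem (-i) v hv, hQ.y_mem, hQ.x_mem⟩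
    exact ⟨N, P, hNP, hN, hP, key hsN, key hsP⟩

/-- A stable `ℂ[[t]]`-submodule, as a `B_{k,n}`-submodule. -/
noncomputable def submoduleOfStable (hk : 0 < k) (hkn : k < n) [Module.Finite ℂ⟦X⟧ M]
    (N : Submodule ℂ⟦X⟧ M)
    (hN : IsStable (fun i => act M (proj k n (idem n i))) (act M (proj k n (xSum n)))
      (act M (proj k n (ySum n))) N) : Submodule (BoundaryAlgebra k n) M :=
  { N.toAddSubmonoid with smul_mem' := fun b _ hm => smul_mem_of_isStable hk hkn hN b hm }

end BoundaryAlgebra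

theorem corollary3p6 (k n : ℕ) [NeZero n] (hk : 0 < k) (hkn : k < n) (hn : n < 6)
    (M : Type u) [AddCommGroup M] [Module (BoundaryAlgebra k n) M]
    [Module ℂ⟦X⟧ M] [IsScalarTower ℂ⟦X⟧ (BoundaryAlgebra k n) M]
    (hCM : BoundaryAlgebra.IsCohenMacaulay k n M) (hrank : BoundaryAlgebra.rank k n M = 2) :
    ¬ IsIndecomposableModule (BoundaryAlgebra k n) M := by
  rintro ⟨-, hind⟩
  have := hCM.1
  obtain ⟨N, P, hNP, hN, hP, hsN, hsP⟩ :=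
    BoundaryAlgebra.exists_isCompl_isStable hk hkn hn hCM hrank
  have hbot : ∀ {Q : Submodule ℂ⟦X⟧ M} (hQ), BoundaryAlgebra.submoduleOfStable hk hkn Q hQ = ⊥ →
      Q = ⊥ := fun {Q} hQ h0 => by
    rw [eq_bot_iff]
    intro v hv
    have : v ∈ BoundaryAlgebra.submoduleOfStable hk hkn Q hQ := hv
    rwa [h0] at this
  -- The submodules over `B_{k,n}` have the same carriers as `N` and `P`, so complementarity carries
  -- over.
  refine (hind (BoundaryAlgebra.submoduleOfStable hk hkn N hsN)
    (BoundaryAlgebra.submoduleOfStable hk hkn P hsP) ⟨?_, ?_⟩).elim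
    (fun h => hN (hbot hsN h)) fun h => hP (hbot hsP h)
  · exact Submodule.disjoint_def.2 fun v hv hv' => Submodule.disjoint_def.1 hNP.disjoint v hv hv'
  · rw [codisjoint_iff, eq_top_iff]
    intro v _
    have hv : v ∈ N ⊔ P := by rw [hNP.sup_eq_top]; trivial
    obtain ⟨a, ha, b, hb, rfl⟩ := Submodule.mem_sup.1 hv
    exact Submodule.add_mem_sup (S := BoundaryAlgebra.submoduleOfStable hk hkn N hsN) ha hb
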